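/- **Theorem.** Let $n\ge 0$, $k\ge 2$, let $M$ be an $n$-dimensional $C^\infty$ manifold (Hausdorff, second countable, without boundary), let $S=\{1,\dots,k\}$, and let $u_1,\dots,u_k$ be smooth forward complete vector fields on $M$, i.e. for every $\eta\in M$ the trajectory $t\mapsto\Phi_i(t,\eta)$ of $\dot x=u_i(x)$ with $\Phi_i(0,\eta)=\eta$ exists for all $t\ge 0$. Let $\lambda_i>0$ for $i\in S$, and for $i\neq j$ let $p_{ij}>0$ with $\sum_{j\ne i}p_{ij}=1$ for every $i$. For $(\xi,i)\in M\times S$ consider the process $(X_t,A_t)_{t\ge 0}$ started at $(\xi,i)$: $A$ is the Markov jump process on $S$ which stays in a state $j$ for an exponentially distributed time with parameter $\lambda_j$ and then switches from $j$ to $l\neq j$ with probability $p_{jl}$, the times between switches being independent conditionally on the sequence of visited states; $X$ is continuous, and it follows the flow $\Phi_j$ while $A=j$. Let $\mathsf P^t_{\xi,i}$ be the distribution of $(X_t,A_t)$ on $M\times S$ (with the product of the Borel $\sigma$-algebra of $M$ and the power set of $S$). A probability measure $\mu$ on $M\times S$ is called invariant if $\mu(E)=\int \mathsf P^t_{\xi,i}(E)\,\mu(d(\xi,i))$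 for all $t\ge 0$ and all measurable $E$. A measurable set $A\subset M\times S$ is called $\mu$-invariant if for every $t\ge 0$ we have $\mathsf P^t_{\xi,i}(A)=1$ for $\mu$-almost every $(\xi,i)\in A$. An invariant probability measure $\mu$ is called ergodic if $\mu(A)\in\{0,1\}$ for every $\mu$-invariant set $A$. Let $\mathcal I$ be the smallest real linear space of smooth vector fields on $M$ that contains $u_1,\dots,u_k$ and is closed under the Lie bracket. A point $\eta\in M$ satisfies Condition B if $\dim\{v(\eta): v\in\mathcal I\}=n$. Lebesgue measure on $M$ is a Borel measure on $M$ whose image under every chart is equivalent to Lebesgue measure on the range of the chart (such measures exist, by means of a partition of unity, and they all have the same null sets); Lebesgue measure on $M\times S$ is its product with the counting measure on $S$. Let $\mu$ be an ergodic invariant probability measure for $(\mathsf P^t)_{t\ge0}$, and assume that the support of $\mu$ (the set of points all of whose open neighbourhoods have positive $\mu$-measure, $S$ being discrete) contains a point $(\eta,i)$ such that $\eta$ satisfies Condition B. Then $\mu$ is absolutely continuous with respect to Lebesgue measure on $M\times S$. -/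

import Mathlib

open Set Filter MeasureTheory ProbabilityTheory
open scoped Topology Manifold ContDiff

namespace Switching

noncomputable section

/-! ### Vector fields, flows and the bracket condition -/

section Geometry

variable {n : ℕ} {M : Type*} [TopologicalSpace M] [ChartedSpace (EuclideanSpace ℝ (Fin n)) M]

/-- A vector field is smooth if it is a smooth section of the tangent bundle. -/
def IsSmoothField [IsManifold (𝓡 n) ∞ M] (V : Π x : M, TangentSpace (𝓡 n) x) : Prop :=
  ContMDiff (𝓡 n) (𝓡 n).tangent ∞ (fun x => (⟨x, V x⟩ : TangentBundle (𝓡 n) M))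

/-- `γ` restricted to `[0, ∞)` solves the initial value problem `γ' = V(γ)`, `γ(0) = η`
(with the one-sided derivative at time `0`). -/
def IsForwardTrajectory (V : Π x : M, TangentSpace (𝓡 n) x) (η : M) (γ : ℝ → M) : Prop :=
  γ 0 = η ∧ IsMIntegralCurveOn γ V (Ici 0)

/-- A vector field is forward complete if its trajectories exist for all positive times. -/
def IsForwardComplete (V : Π x : M, TangentSpace (𝓡 n) x) : Prop :=
  ∀ η : M, ∃ γ : ℝ → M, IsForwardTrajectory V η γ

open Classical in
/-- The forward flow: for a smooth forward complete field `V` on a Hausdorff manifold and `0 ≤ t`,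
`flow V t η` is the position at time `t` of the unique trajectory of `V` started at `η`.
The value `η` in the remaining cases is a dummy. -/
def flow (V : Π x : M, TangentSpace (𝓡 n) x) (t : ℝ) (η : M) : M :=
  if h : 0 ≤ t ∧ ∃ γ : ℝ → M, IsForwardTrajectory V η γ then h.2.choose t else η

/-- A linear space of smooth vector fields that is closed under the Lie bracket. -/
structure IsSubalgebra [IsManifold (𝓡 n) ∞ M]
    (A : Submodule ℝ (Π x : M, TangentSpace (𝓡 n) x)) : Prop where
  smooth : ∀ V ∈ A, IsSmoothField V
  bracket : ∀ V ∈ A, ∀ W ∈ A, VectorField.mlieBracket (𝓡 n) V W ∈ A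

/-- The smallest subalgebra of the Lie algebra of smooth vector fields that contains a given
family `u` (of smooth fields). -/
def generatedAlgebra [IsManifold (𝓡 n) ∞ M] {ι : Type*}
    (u : ι → Π x : M, TangentSpace (𝓡 n) x) :
    Submodule ℝ (Π x : M, TangentSpace (𝓡 n) x) :=
  sInf {A | IsSubalgebra A ∧ ∀ i, u i ∈ A}

/-- The smooth vector fields form a subalgebra, so that `generatedAlgebra` is an infimum over a
nonempty family. -/
theorem exists_isSubalgebra [IsManifold (𝓡 n) ∞ M] {ι : Type*}
    (u : ι → Π x : M, TangentSpace (𝓡 n) x) (hu : ∀ i, IsSmoothField (u i)) :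
    ∃ A, IsSubalgebra A ∧ ∀ i, u i ∈ A := by
  refine ⟨{ carrier := {V | IsSmoothField V}
            add_mem' := fun hV hW => ContMDiff.add_section hV hW
            zero_mem' := Bundle.contMDiff_zeroSection ℝ (TangentSpace (𝓡 n) (M := M))
            smul_mem' := fun c _ hV => ContMDiff.const_smul_section (a := c) hV }, ⟨?_, ?_⟩, hu⟩
  · exact fun V hV => hV
  · intro V hV W hW
    have : IsManifold (𝓡 n) (((⊤ : ℕ∞) : ℕ∞ω) + 1) M := by
      simpa using (inferInstance : IsManifold (𝓡 n) ∞ M)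
    have : IsManifold (𝓡 n) (minSmoothness ℝ 2) M :=
      IsManifold.of_le (n := ∞) (by
        rw [minSmoothness_of_isRCLikeNormedField]
        exact ENat.LEInfty.out)
    have : IsManifold (𝓡 n) (minSmoothness ℝ 3) M :=
      IsManifold.of_le (n := ∞) (by
        rw [minSmoothness_of_isRCLikeNormedField]
        exact ENat.LEInfty.out)
    exact ContDiff.mlieBracket_vectorField (m := ⊤) (n := ⊤) hV hW (by simp)

/-- The generated Lie algebra, evaluated at `ξ`, is `n`-dimensional. -/
def ConditionB [IsManifold (𝓡 n) ∞ M] {ι : Type*}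
    (u : ι → Π x : M, TangentSpace (𝓡 n) x) (ξ : M) : Prop :=
  Module.finrank ℝ
    ((generatedAlgebra u).map
      (LinearMap.proj ξ : (Π x : M, TangentSpace (𝓡 n) x) →ₗ[ℝ] TangentSpace (𝓡 n) ξ)) = n

end Geometry

/-! ### Lebesgue measure on a manifold -/

section Lebesgue

theorem sigmaCompactSpace (n : ℕ) (M : Type*) [TopologicalSpace M] [SecondCountableTopology M]
    [ChartedSpace (EuclideanSpace ℝ (Fin n)) M] : SigmaCompactSpace M := by
  have : LocallyCompactSpace M := ChartedSpace.locallyCompactSpace (EuclideanSpace ℝ (Fin n)) M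
  infer_instance

variable (n : ℕ) (M : Type*) [TopologicalSpace M] [T2Space M] [SecondCountableTopology M]
  [ChartedSpace (EuclideanSpace ℝ (Fin n)) M]

/-- A smooth partition of unity subordinate to the domains of the preferred charts. -/
def chartPartition [IsManifold (𝓡 n) ∞ M] : SmoothPartitionOfUnity M (𝓡 n) M univ :=
  have := sigmaCompactSpace n M
  (SmoothPartitionOfUnity.exists_isSubordinate_chartAt_source (𝓡 n) M).choose

theorem chartPartition_isSubordinate [IsManifold (𝓡 n) ∞ M] :
    (chartPartition n M).IsSubordinate
      (fun x => (chartAt (EuclideanSpace ℝ (Fin n)) x).source) :=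
  have := sigmaCompactSpace n M
  (SmoothPartitionOfUnity.exists_isSubordinate_chartAt_source (𝓡 n) M).choose_spec

variable [MeasurableSpace M]

/-- Lebesgue measure in the coordinate patch of the preferred chart at `c`, seen on `M`. -/
def patchMeasure {M : Type*} [TopologicalSpace M]
    [ChartedSpace (EuclideanSpace ℝ (Fin n)) M] [MeasurableSpace M] (c : M) : Measure M :=
  (volume.restrict (chartAt (EuclideanSpace ℝ (Fin n)) c).target).map
    (chartAt (EuclideanSpace ℝ (Fin n)) c).symm

/-- Lebesgue measure on `M`: the Lebesgue measures of the coordinate patches, glued with the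
partition of unity. Its image under every chart is equivalent to Lebesgue measure, see
`lebesgueMeasure_map_chart` below. -/
def lebesgueMeasure [IsManifold (𝓡 n) ∞ M] : Measure M :=
  Measure.sum fun c : M =>
    (patchMeasure n c).withDensity fun x => ENNReal.ofReal (chartPartition n M c x)

end Lebesgue

section LebesgueCharts

variable {n : ℕ} {M : Type*} [TopologicalSpace M] [ChartedSpace (EuclideanSpace ℝ (Fin n)) M]

/-- Coordinate changes preserve Lebesgue null sets. -/
theorem null_image_of_null_image [IsManifold (𝓡 n) ∞ M]
    {e f : OpenPartialHomeomorph M (EuclideanSpace ℝ (Fin n))}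
    (he : e ∈ IsManifold.maximalAtlas (𝓡 n) ∞ M) (hf : f ∈ IsManifold.maximalAtlas (𝓡 n) ∞ M)
    {E : Set M} (hE : E ⊆ e.source ∩ f.source) (h0 : volume (e '' E) = 0) :
    volume (f '' E) = 0 := by
  have hd : ContMDiffOn (𝓡 n) (𝓡 n) ∞ (f ∘ e.symm) (e '' E) := by
    refine (contMDiffOn_of_mem_maximalAtlas hf).comp
      ((contMDiffOn_symm_of_mem_maximalAtlas he).mono ?_) ?_
    · rintro _ ⟨x, hx, rfl⟩
      exact e.map_source (hE hx).1
    · rintro _ ⟨x, hx, rfl⟩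
      simpa [e.left_inv (hE hx).1] using (hE hx).2
  have hd' : DifferentiableOn ℝ (f ∘ e.symm) (e '' E) :=
    (contMDiffOn_iff_contDiffOn.1 hd).differentiableOn (by simp)
  have := addHaar_image_eq_zero_of_differentiableOn_of_addHaar_eq_zero volume hd' h0
  rwa [image_image, image_congr fun x hx => by
    rw [Function.comp_apply, e.left_inv (hE hx).1]] at this

variable [MeasurableSpace M] [BorelSpace M]

theorem patchMeasure_apply (c : M) {E : Set M} (hE : MeasurableSet E) :
    patchMeasure n c E = volume (chartAt (EuclideanSpace ℝ (Fin n)) c ''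
      (E ∩ (chartAt (EuclideanSpace ℝ (Fin n)) c).source)) := by
  set f := chartAt (EuclideanSpace ℝ (Fin n)) c
  have hm : AEMeasurable f.symm (volume.restrict f.target) :=
    f.continuousOn_symm.aemeasurable f.open_target.measurableSet
  rw [patchMeasure, Measure.map_apply_of_aemeasurable hm hE,
    Measure.restrict_apply' f.open_target.measurableSet]
  congr 1
  rw [inter_comm E, f.image_source_inter_eq', inter_comm]

variable [T2Space M] [SecondCountableTopology M] [IsManifold (𝓡 n) ∞ M]

/-- The image of Lebesgue measure on `M` under every chart is equivalent to Lebesgue measure. -/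
theorem lebesgueMeasure_map_chart {e : OpenPartialHomeomorph M (EuclideanSpace ℝ (Fin n))}
    (he : e ∈ IsManifold.maximalAtlas (𝓡 n) ∞ M) :
    ((lebesgueMeasure n M).restrict e.source).map e ≪ volume.restrict e.target ∧
      volume.restrict e.target ≪ ((lebesgueMeasure n M).restrict e.source).map e := by
  have hm : AEMeasurable e ((lebesgueMeasure n M).restrict e.source) :=
    e.continuousOn.aemeasurable e.open_source.measurableSet
  have key : ∀ A : Set (EuclideanSpace ℝ (Fin n)), MeasurableSet A →
      (((lebesgueMeasure n M).restrict e.source).map e A = 0 ↔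
        volume.restrict e.target A = 0) := by
    intro A hA
    have hEm : MeasurableSet (e.source ∩ e ⁻¹' A) := by
      have := e.open_source.measurableSet
      have h2 : Measurable fun x : e.source => e x :=
        (continuousOn_iff_continuous_domRestrict.1 e.continuousOn).measurable
      have h3 := this.subtype_image (h2 hA)
      convert h3 using 1
      ext x
      simp [and_comm]
    rw [Measure.map_apply_of_aemeasurable hm hA,
      Measure.restrict_apply' e.open_source.measurableSet,
      Measure.restrict_apply' e.open_target.measurableSet, inter_comm, inter_comm A]
    set E := e.source ∩ e ⁻¹' A with hEdef
    have himg : e.target ∩ A = e '' E := by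
      ext y
      constructor
      · rintro ⟨hy, hyA⟩
        exact ⟨e.symm y, ⟨e.map_target hy, by simpa [e.right_inv hy] using hyA⟩, e.right_inv hy⟩
      · rintro ⟨x, hx, rfl⟩
        exact ⟨e.map_source hx.1, hx.2⟩
    have hρ : ∀ c : M, Measurable fun x => ENNReal.ofReal (chartPartition n M c x) := fun c =>
      ((chartPartition n M c).contMDiff.continuous.measurable).ennreal_ofReal
    have hset : ∀ c : M, {x | ENNReal.ofReal (chartPartition n M c x) ≠ 0} =
        {x | 0 < chartPartition n M c x} := fun c => by
      ext x
      simp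
    have hopen : ∀ c : M, IsOpen {x | 0 < chartPartition n M c x} := fun c =>
      isOpen_lt continuous_const (chartPartition n M c).contMDiff.continuous
    rw [lebesgueMeasure, Measure.sum_apply_eq_zero' hEm, himg]
    have hchart := fun c : M => IsManifold.chart_mem_maximalAtlas (I := 𝓡 n) (n := ∞) c
    simp only [withDensity_apply_eq_zero (hρ _), hset]
    constructor
    · intro h
      obtain ⟨T, hT, hTU⟩ := TopologicalSpace.isOpen_iUnion_countable _ hopen
      have hcov : e '' E ⊆ ⋃ c ∈ T, e '' ({x | 0 < chartPartition n M c x} ∩ E) := by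
        rintro _ ⟨x, hx, rfl⟩
        obtain ⟨c, hc⟩ := (chartPartition n M).exists_pos_of_mem (mem_univ x)
        have : x ∈ ⋃ c ∈ T, {x | 0 < chartPartition n M c x} := by
          rw [hTU]
          exact mem_iUnion.2 ⟨c, hc⟩
        obtain ⟨c, hcT, hc⟩ := mem_iUnion₂.1 this
        exact mem_iUnion₂.2 ⟨c, hcT, x, ⟨hc, hx⟩, rfl⟩
      refine measure_mono_null hcov ((measure_biUnion_null_iff hT).2 fun c _ => ?_)
      have hsub : {x | 0 < chartPartition n M c x} ⊆
          (chartAt (EuclideanSpace ℝ (Fin n)) c).source := fun x hx =>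
        chartPartition_isSubordinate n M c (subset_tsupport _ (ne_of_gt hx))
      have h0 := h c
      rw [patchMeasure_apply c ((hopen c).measurableSet.inter hEm),
        inter_eq_left.2 (inter_subset_left.trans hsub)] at h0
      exact null_image_of_null_image (hchart c) he
        (fun x hx => ⟨hsub hx.1, hx.2.1⟩) h0
    · intro h c
      refine measure_mono_null inter_subset_right ?_
      rw [patchMeasure_apply c hEm]
      exact null_image_of_null_image he (hchart c)
        (fun x hx => ⟨hx.1.1, hx.2⟩) (measure_mono_null (image_mono inter_subset_left) h)
  exact ⟨Measure.AbsolutelyContinuous.mk fun A hA h => (key A hA).2 h,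
    Measure.AbsolutelyContinuous.mk fun A hA h => (key A hA).1 h⟩

end LebesgueCharts

/-! ### The switching process -/

/-- The switching mechanism: in state `i` the process waits for an exponential time with
parameter `rate i` and then switches to `j ≠ i` with positive probability `jump i j`. -/
structure SwitchingLaw (k : ℕ) where
  rate : Fin k → ℝ
  rate_pos : ∀ i, 0 < rate i
  jump : Fin k → Fin k → ℝ
  jump_self : ∀ i, jump i i = 0
  jump_pos : ∀ i j, i ≠ j → 0 < jump i j
  jump_sum : ∀ i, ∑ j, jump i j = 1

namespace SwitchingLaw

variable {k : ℕ} (law : SwitchingLaw k)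

/-- The joint law of a deterministic state `i` and the waiting time spent in it. -/
def stay (i : Fin k) : Measure (Fin k × ℝ) :=
  (Measure.dirac i).prod (expMeasure (law.rate i))

/-- The joint law of the state that follows `i` and the waiting time spent in it. -/
def next (i : Fin k) : Measure (Fin k × ℝ) :=
  ∑ j, ENNReal.ofReal (law.jump i j) • law.stay j

instance (i : Fin k) : IsProbabilityMeasure (law.stay i) := by
  have := isProbabilityMeasure_expMeasure (law.rate_pos i)
  unfold stay
  infer_instance

instance (i : Fin k) : IsProbabilityMeasure (law.next i) := by
  constructor
  have h0 : ∀ j, 0 ≤ law.jump i j := fun j => by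
    rcases eq_or_ne i j with rfl | h
    · exact (law.jump_self i).ge
    · exact (law.jump_pos i j h).le
  simp [next, Measure.finsetSum_apply, ← ENNReal.ofReal_sum_of_nonneg (fun j _ => h0 j),
    law.jump_sum]

/-- One step of the Markov chain of pairs (state, waiting time in this state): the next pair
depends on the past through the current state only. -/
def step (m : ℕ) : Kernel (Π _ : Finset.Iic m, Fin k × ℝ) (Fin k × ℝ) :=
  (Kernel.ofFunOfCountable law.next).comap (fun h => (h ⟨m, Finset.mem_Iic.2 le_rfl⟩).1)
    (measurable_fst.comp (measurable_pi_apply _))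

instance (m : ℕ) : IsMarkovKernel (law.step m) := by
  have : IsMarkovKernel (Kernel.ofFunOfCountable law.next) :=
    ⟨fun i => inferInstanceAs (IsProbabilityMeasure (law.next i))⟩
  unfold step
  infer_instance

/-- The law of the sequence of (visited state, waiting time in it), with initial state `i`. -/
def chain (i : Fin k) : Measure (ℕ → Fin k × ℝ) :=
  Kernel.trajMeasure (X := fun _ => Fin k × ℝ) (law.stay i) law.step

end SwitchingLaw

section Paths

variable {k : ℕ}

/-- The time of the `m`-th switch (`0` for `m = 0`). -/
def switchTime (w : ℕ → Fin k × ℝ) (m : ℕ) : ℝ := ∑ l ∈ Finset.range m, (w l).2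

/-- The number of switches up to time `t`, i.e. the largest `m` with `switchTime w m ≤ t`. -/
def switchCount (w : ℕ → Fin k × ℝ) (t : ℝ) : ℕ := sSup {m | switchTime w m ≤ t}

variable {n : ℕ} {M : Type*} [TopologicalSpace M] [ChartedSpace (EuclideanSpace ℝ (Fin n)) M]
  (u : Fin k → Π x : M, TangentSpace (𝓡 n) x)

/-- The position in `M` at the time of the `m`-th switch, started at `ξ`. -/
def switchPosition (w : ℕ → Fin k × ℝ) (ξ : M) : ℕ → M
  | 0 => ξ
  | m + 1 => flow (u (w m).1) (w m).2 (switchPosition w ξ m)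

/-- The pair (position, driving state) at time `t`, started at position `ξ`. -/
def processAt (w : ℕ → Fin k × ℝ) (ξ : M) (t : ℝ) : M × Fin k :=
  (flow (u (w (switchCount w t)).1) (t - switchTime w (switchCount w t))
    (switchPosition u w ξ (switchCount w t)), (w (switchCount w t)).1)

variable [MeasurableSpace M] (law : SwitchingLaw k)

/-- The transition probability measure: the distribution of the process at time `t` if it is
started at `z = (ξ, i)`. -/
def transition (t : ℝ) (z : M × Fin k) : Measure (M × Fin k) :=
  (law.chain z.2).map fun w => processAt u w z.1 t

/-- `μ` is invariant: `μ P^t = μ` for all `t ≥ 0`. -/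
def IsInvariant (μ : Measure (M × Fin k)) : Prop :=
  ∀ t : ℝ, 0 ≤ t → ∀ E : Set (M × Fin k), MeasurableSet E →
    ∫⁻ z, transition u law t z E ∂μ = μ E

/-- A measurable set is `μ`-invariant if for every `t ≥ 0`, from `μ`-almost every starting point
in the set the process is in the set at time `t` with probability one. -/
def IsInvariantSet (μ : Measure (M × Fin k)) (A : Set (M × Fin k)) : Prop :=
  MeasurableSet A ∧ ∀ t : ℝ, 0 ≤ t → ∀ᵐ z ∂μ, z ∈ A → transition u law t z A = 1

/-- An invariant probability measure is ergodic if all invariant sets have measure `0` or `1`. -/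
structure IsErgodic (μ : Measure (M × Fin k)) : Prop where
  isProbabilityMeasure : IsProbabilityMeasure μ
  invariant : IsInvariant u law μ
  zero_or_one : ∀ A, IsInvariantSet u law μ A → μ A = 1 ∨ μ A = 0

end Paths

end

end Switching

/-! Suppose that `μ` is not absolutely continuous. For a fixed sequence of states and waiting times
the process is a composition of flow maps, and preimages of null sets under flow maps are null. So
mass in the absolutely continuous part never enters a null set that carries the singular part.
Invariance then makes such a set `N` a `μ`-invariant set, and ergodicity gives `μ N = 1`
(`exists_null_carrier`). By Fubini, for `μ`-almost every start the process almost surely spends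
almost all times in `N` (`ae_staysIn`). Since the support contains `(η, i)` and Condition B is an
open condition, there is such a start `(ξ, i)` with `ξ` near `η`, in a region where the generated
algebra spans.

The law of a waiting time dominates Lebesgue measure on the positive half-line, and every other
state can follow. Conditioning on the first switch therefore turns an almost sure statement about
the process into a statement about almost every point of a trajectory. The property "`StaysInAlong`
for every state" is inherited from a point by almost all points on the forward trajectories of every
`u l` (`StaysInAlong.ae_forall`); call such a property hereditary.

A hereditary property spreads as in Krener's theorem. Start with the single point and suppose that
it holds at almost every parameter of an immersed manifold of dimension less than `n`. Some `u l` is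
transversal to the manifold somewhere: otherwise all `u l` would be tangent, hence so would their
brackets, and the generated algebra could not span. Flowing along this `u l` for small positive
times raises the dimension by one, and Fubini preserves "almost every". In dimension `n` the
property holds almost everywhere on a nonempty open set (`exists_open_ae`). But a point with the
property has almost all of its trajectory in a null slice of `N`, and such points form a null set
(`lebesgueMeasure_ae_flow_mem_eq_zero`). This is the contradiction.

The analytic input is that flows are locally `C²` in time and initial value. It comes from the
implicit function theorem on a space of continuous paths (`exists_contDiffAt_flow`). Non-explosion
of the switching times is not needed: `StaysIn` makes its claim only at times before the switches
accumulate, and a decomposition at the first switch preserves this restriction. -/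

namespace Switching

open scoped ENNReal

/-! ### Decomposition of the switching chain at the first switch -/

section Chain

variable {k : ℕ} (law : SwitchingLaw k)

instance (i : Fin k) : IsProbabilityMeasure (law.chain i) := by
  unfold SwitchingLaw.chain
  infer_instance

/-- Put a pair (state, waiting time) in front of a sequence of such pairs. -/
def consPath (p : (Fin k × ℝ) × (ℕ → Fin k × ℝ)) : ℕ → Fin k × ℝ
  | 0 => p.1
  | m + 1 => p.2 m

theorem measurable_consPath : Measurable (consPath (k := k)) := by
  refine measurable_pi_iff.2 fun m => ?_
  cases m with
  | zero => exact measurable_fst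
  | succ m => exact (measurable_pi_apply m).comp measurable_snd

theorem map_eval_zero_chain (i : Fin k) :
    (law.chain i).map (fun w => w 0) = law.stay i := by
  have h1 : (law.chain i).map (Preorder.frestrictLe 0) =
      (law.stay i).map (MeasurableEquiv.piUnique
        (fun _ : Finset.Iic (0 : ℕ) => Fin k × ℝ)).symm := by
    unfold SwitchingLaw.chain Kernel.trajMeasure
    rw [Measure.map_comp _ _ (by fun_prop), Kernel.traj_map_frestrictLe, Kernel.partialTraj_self]
    simp
  have h2 : (fun w : ℕ → Fin k × ℝ => w 0) =
      (fun h : (Π _ : Finset.Iic (0 : ℕ), Fin k × ℝ) => h ⟨0, by simp⟩) ∘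
        (Preorder.frestrictLe 0) := rfl
  rw [h2, ← Measure.map_map (by fun_prop) (by fun_prop), h1,
    Measure.map_map (by fun_prop) (by fun_prop)]
  exact Measure.map_id

/-- The Markov property tested on products: the law of the first `a + 1` pairs composed with the
kernel `step a` is their joint law with the next pair. The inner integral depends only on the state
at `a`, so it can be merged into a factor there. -/
theorem lintegral_chain_tower (i : Fin k) (a : ℕ) (f : ℕ → Fin k × ℝ → ℝ≥0∞)
    (hf : ∀ l, Measurable (f l)) (g : Fin k × ℝ → ℝ≥0∞) (hg : Measurable g) :
    ∫⁻ w, (∏ l ∈ Finset.range (a + 1), f l (w l)) * g (w (a + 1)) ∂law.chain i =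
      ∫⁻ w, (∏ l ∈ Finset.range (a + 1), f l (w l)) * ∫⁻ y, g y ∂law.next (w a).1
        ∂law.chain i := by
  set F : (Π _ : Finset.Iic a, Fin k × ℝ) → ℝ≥0∞ := fun h => ∏ l : Finset.Iic a, f l (h l)
  have hF : Measurable F := by fun_prop
  have hFr : ∀ w : ℕ → Fin k × ℝ,
      F (Preorder.frestrictLe a w) = ∏ l ∈ Finset.range (a + 1), f l (w l) := fun w => by
    rw [Nat.range_succ_eq_Iic, ← Finset.prod_coe_sort (Finset.Iic a)]
    rfl
  have key := Kernel.map_frestrictLe_trajMeasure_compProd_eq_map_trajMeasure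
    (X := fun _ => Fin k × ℝ) (μ₀ := law.stay i) (κ := law.step) (a := a)
  have h1 := congrArg (fun m => ∫⁻ p, F p.1 * g p.2 ∂m) key
  rw [lintegral_map (by fun_prop) (by fun_prop), Measure.lintegral_compProd (by fun_prop)] at h1
  simp only [hFr] at h1
  change _ = ∫⁻ w, (∏ l ∈ Finset.range (a + 1), f l (w l)) * g (w (a + 1)) ∂law.chain i at h1
  rw [← h1, lintegral_map (Measurable.lintegral_kernel_prod_right' (κ := law.step a)
    (f := fun p => F p.1 * g p.2) (by fun_prop)) (by fun_prop)]
  refine lintegral_congr fun w => ?_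
  simp only
  rw [lintegral_const_mul _ hg, hFr]
  rfl

theorem lintegral_stay (i : Fin k) {f : Fin k × ℝ → ℝ≥0∞} (hf : Measurable f) :
    ∫⁻ x, f x ∂law.stay i = ∫⁻ s, f (i, s) ∂expMeasure (law.rate i) := by
  have := isProbabilityMeasure_expMeasure (law.rate_pos i)
  rw [SwitchingLaw.stay, lintegral_prod _ hf.aemeasurable, lintegral_dirac]

theorem lintegral_chain_zero (i : Fin k) {f : Fin k × ℝ → ℝ≥0∞} (hf : Measurable f) :
    ∫⁻ w, f (w 0) ∂law.chain i = ∫⁻ x, f x ∂law.stay i := by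
  rw [← map_eval_zero_chain, lintegral_map hf (measurable_pi_apply 0)]

/-- Induction on the number of factors: the tower property removes the last factor, the induction
hypothesis splits off the first one, and the tower property for the shifted chain puts the last one
back. -/
theorem lintegral_chain_prod (a : ℕ) : ∀ (i : Fin k) (f : ℕ → Fin k × ℝ → ℝ≥0∞),
    (∀ l, Measurable (f l)) →
    ∫⁻ w, ∏ l ∈ Finset.range (a + 2), f l (w l) ∂law.chain i =
      (∫⁻ x, f 0 x ∂law.stay i) * ∑ j, ENNReal.ofReal (law.jump i j) *
        ∫⁻ w, ∏ l ∈ Finset.range (a + 1), f (l + 1) (w l) ∂law.chain j := by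
  induction a with
  | zero =>
    intro i f hf
    have h := lintegral_chain_tower law i 0 f hf (f 1) (hf 1)
    simp only [zero_add, Finset.range_one, Finset.prod_singleton] at h
    simp only [Finset.prod_range_succ, Finset.range_zero, Finset.prod_empty, one_mul, zero_add]
    have hN : Measurable fun x : Fin k × ℝ => ∫⁻ y, f 1 y ∂law.next x.1 :=
      (measurable_of_finite (fun i : Fin k => ∫⁻ y, f 1 y ∂law.next i)).comp measurable_fst
    rw [h, lintegral_chain_zero law i (f := fun x => f 0 x * ∫⁻ y, f 1 y ∂law.next x.1)
      ((hf 0).mul hN), lintegral_stay law i (f := fun x => f 0 x * ∫⁻ y, f 1 y ∂law.next x.1)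
      ((hf 0).mul hN)]
    change ∫⁻ s, f 0 (i, s) * ∫⁻ y, f 1 y ∂law.next i ∂expMeasure (law.rate i) = _
    rw [lintegral_mul_const _ (f := fun s => f 0 (i, s)) ((hf 0).comp measurable_prodMk_left),
      ← lintegral_stay law i (hf 0)]
    congr 1
    rw [SwitchingLaw.next, lintegral_finsetSum_measure]
    refine Finset.sum_congr rfl fun j _ => ?_
    rw [lintegral_smul_measure, lintegral_chain_zero law j (hf 1), smul_eq_mul]
  | succ a ih =>
    intro i f hf
    set g : Fin k × ℝ → ℝ≥0∞ := fun x => ∫⁻ y, f (a + 2) y ∂law.next x.1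
    have hg : Measurable g :=
      (measurable_of_finite (fun i : Fin k => ∫⁻ y, f (a + 2) y ∂law.next i)).comp measurable_fst
    -- The conditional expectation of the last factor, absorbed into the factor before it; the index
    -- `0` is not affected.
    set f' : ℕ → Fin k × ℝ → ℝ≥0∞ := Function.update f (a + 1) (fun x => f (a + 1) x * g x)
    have hf' : ∀ l, Measurable (f' l) := by
      intro l
      by_cases hl : l = a + 1
      · subst hl
        simp only [f', Function.update_self]
        exact (hf (a + 1)).mul hg
      · simpa [f', hl] using hf l
    have hlt : ∀ l, l < a + 1 → f' l = f l := fun l hl => by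
      simp [f', hl.ne]
    have h1 := lintegral_chain_tower law i (a + 1) f hf (f (a + 2)) (hf _)
    have h2 : ∀ j, _ := fun j => lintegral_chain_tower law j a (fun l => f (l + 1))
      (fun l => hf _) (f (a + 2)) (hf _)
    have h3 := ih i f' hf'
    have e1 : ∀ w : ℕ → Fin k × ℝ, ∏ l ∈ Finset.range (a + 2), f' l (w l) =
        (∏ l ∈ Finset.range (a + 2), f l (w l)) * g (w (a + 1)) := fun w => by
      rw [Finset.prod_range_succ, Finset.prod_range_succ (n := a + 1),
        Finset.prod_congr rfl fun l hl => by rw [hlt l (Finset.mem_range.1 hl)]]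
      simp [f', mul_assoc]
    have e2 : ∀ w : ℕ → Fin k × ℝ, ∏ l ∈ Finset.range (a + 1), f' (l + 1) (w l) =
        (∏ l ∈ Finset.range (a + 1), f (l + 1) (w l)) * g (w a) := fun w => by
      rw [Finset.prod_range_succ, Finset.prod_range_succ (n := a),
        Finset.prod_congr rfl fun l hl => by rw [hlt (l + 1) (by simpa using hl)]]
      simp [f', mul_assoc]
    simp only [e1, e2, hlt 0 (Nat.succ_pos a)] at h3
    simp only [Finset.prod_range_succ (n := a + 2), h1]
    rw [h3]
    congr 1
    refine Finset.sum_congr rfl fun j _ => ?_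
    simp only [Finset.prod_range_succ (n := a + 1), h2 j]
    rfl

/-- The chain started in `i` is a waiting time in `i` followed by the chain started in a random
state that is chosen according to `jump i`. -/
theorem chain_eq_sum_map_consPath (i : Fin k) :
    law.chain i = ∑ j, ENNReal.ofReal (law.jump i j) •
      (((law.stay i).prod (law.chain j)).map consPath) := by
  set ν : Measure (ℕ → Fin k × ℝ) := ∑ j, ENNReal.ofReal (law.jump i j) •
      (((law.stay i).prod (law.chain j)).map consPath) with hν
  have hlint : ∀ F : (ℕ → Fin k × ℝ) → ℝ≥0∞, Measurable F → ∫⁻ w, F w ∂ν =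
      ∑ j, ENNReal.ofReal (law.jump i j) *
        ∫⁻ x, ∫⁻ w, F (consPath (x, w)) ∂law.chain j ∂law.stay i := fun F hF => by
    rw [hν, lintegral_finsetSum_measure]
    refine Finset.sum_congr rfl fun j _ => ?_
    rw [lintegral_smul_measure, lintegral_map hF measurable_consPath, smul_eq_mul,
      lintegral_prod (fun p => F (consPath p)) (hF.comp measurable_consPath).aemeasurable]
  have hbox : ∀ (a : ℕ) (f : ℕ → Fin k × ℝ → ℝ≥0∞), (∀ l, Measurable (f l)) →
      ∫⁻ w, ∏ l ∈ Finset.range (a + 2), f l (w l) ∂law.chain i =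
        ∫⁻ w, ∏ l ∈ Finset.range (a + 2), f l (w l) ∂ν := by
    intro a f hf
    rw [lintegral_chain_prod law a i f hf, hlint _ (by fun_prop), Finset.mul_sum]
    refine Finset.sum_congr rfl fun j _ => ?_
    have : ∀ (x : Fin k × ℝ) (w : ℕ → Fin k × ℝ),
        ∏ l ∈ Finset.range (a + 2), f l (consPath (x, w) l) =
          (f 0 x) * ∏ l ∈ Finset.range (a + 1), f (l + 1) (w l) := fun x w => by
      rw [Finset.prod_range_succ', mul_comm]
      rfl
    simp only [this]
    have h1 : ∀ x, ∫⁻ w, (f 0 x) * ∏ l ∈ Finset.range (a + 1), f (l + 1) (w l) ∂law.chain j =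
        f 0 x * ∫⁻ w, ∏ l ∈ Finset.range (a + 1), f (l + 1) (w l) ∂law.chain j := fun x =>
      lintegral_const_mul _ (by fun_prop)
    simp only [h1]
    rw [lintegral_mul_const _ (hf 0)]
    ring
  have huniv : law.chain i univ = ν univ := by
    simpa using hbox 0 (fun _ _ => 1) (fun _ => measurable_const)
  -- Both measures are finite, so it suffices to compare them on cylinders, whose indicators are
  -- products of the kind covered by `hbox`.
  refine ext_of_generate_finite _ (generateFrom_squareCylinders).symm
    (isPiSystem_squareCylinders (C := fun _ => {s | MeasurableSet s})
      (fun _ => MeasurableSpace.isPiSystem_measurableSet)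
      (fun _ => MeasurableSet.univ (α := Fin k × ℝ))) ?_ huniv
  rintro _ ⟨s, S, hS, rfl⟩
  classical
  have hS' : ∀ l, MeasurableSet (S l) := fun l => hS l (mem_univ l)
  -- The products in `hbox` have at least two factors; coordinates outside `s` get the factor `1`.
  obtain ⟨a, ha⟩ : ∃ a, s ⊆ Finset.range (a + 2) :=
    ⟨s.sup id, fun x hx => by
      have : x ≤ s.sup id := Finset.le_sup (f := id) hx
      simp only [Finset.mem_range]
      omega⟩
  set f : ℕ → Fin k × ℝ → ℝ≥0∞ := fun l => if l ∈ s then (S l).indicator 1 else 1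
  have hf : ∀ l, Measurable (f l) := fun l => by
    by_cases hl : l ∈ s
    · simpa [f, hl] using measurable_one.indicator (hS' l)
    · simpa [f, hl] using measurable_one
  have hm : MeasurableSet ((s : Set ℕ).pi S) :=
    MeasurableSet.pi (Finset.countable_toSet s) fun l _ => hS' l
  have hprod : ∀ w : ℕ → Fin k × ℝ, ∏ l ∈ Finset.range (a + 2), f l (w l) =
      ((s : Set ℕ).pi S).indicator 1 w := fun w => by
    have : ∀ l, f l (w l) = if (l ∈ s → w l ∈ S l) then 1 else 0 := fun l => by
      by_cases hl : l ∈ s <;> simp [f, hl, indicator]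
    simp only [this, Finset.prod_ite_zero, Finset.prod_const_one, indicator, Set.mem_pi,
      Finset.mem_coe, Pi.one_apply]
    congr 1
    exact propext ⟨fun h l hl => h l (ha hl) hl, fun h l _ hl => h l hl⟩
  have := hbox a f hf
  simpa only [hprod, lintegral_indicator_one hm] using this

/-- A set is null for a finite weighted sum of measures iff it is null for each summand with nonzero
weight. The weight `jump i j` vanishes exactly for `j = i`. -/
theorem ae_chain_iff (i : Fin k) {A : (ℕ → Fin k × ℝ) → Prop} (hA : MeasurableSet {w | A w}) :
    (∀ᵐ w ∂law.chain i, A w) ↔ ∀ j, j ≠ i → ∀ᵐ s ∂expMeasure (law.rate i),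
      ∀ᵐ w ∂law.chain j, A (consPath ((i, s), w)) := by
  have := isProbabilityMeasure_expMeasure (law.rate_pos i)
  have hterm : ∀ j, (((law.stay i).prod (law.chain j)).map consPath {w | A w}ᶜ = 0) ↔
      ∀ᵐ s ∂expMeasure (law.rate i), ∀ᵐ w ∂law.chain j, A (consPath ((i, s), w)) := fun j => by
    have hm : MeasurableSet {p : (Fin k × ℝ) × (ℕ → Fin k × ℝ) | A (consPath p)} :=
      measurable_consPath hA
    have hm' : MeasurableSet {x : Fin k × ℝ | ∀ᵐ w ∂law.chain j, A (consPath (x, w))} := by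
      have : Measurable fun x : Fin k × ℝ =>
          law.chain j (Prod.mk x ⁻¹' {p | A (consPath p)}ᶜ) :=
        measurable_measure_prodMk_left hm.compl
      exact this (measurableSet_singleton 0)
    rw [Measure.map_apply measurable_consPath hA.compl]
    change (∀ᵐ p ∂(law.stay i).prod (law.chain j), A (consPath p)) ↔ _
    rw [Measure.ae_prod_iff_ae_ae hm, SwitchingLaw.stay, Measure.dirac_prod,
      ae_map_iff (by fun_prop) hm']
  rw [ae_iff, chain_eq_sum_map_consPath, Measure.finsetSum_apply,
    Finset.sum_eq_zero_iff_of_nonneg (fun _ _ => zero_le)]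
  simp only [Finset.mem_univ, true_implies, Measure.smul_apply, smul_eq_mul, mul_eq_zero]
  refine forall_congr' fun j => ?_
  change _ ∨ ((law.stay i).prod (law.chain j)).map consPath {w | A w}ᶜ = 0 ↔ _
  rw [hterm]
  rcases eq_or_ne j i with rfl | hj
  · simp [law.jump_self]
  · simp [hj, law.jump_pos i j hj.symm]

/-- The exponential density is positive on the positive half-line. Apart from total mass one, this
and nonnegativity are all that is used about waiting times. -/
theorem expMeasure_restrict_Ioi {r : ℝ} (hr : 0 < r) :
    volume.restrict (Ioi (0 : ℝ)) ≪ expMeasure r := by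
  refine Measure.AbsolutelyContinuous.mk fun A hA h => ?_
  have hm : Measurable (gammaPDF 1 r) := (measurable_gammaPDFReal 1 r).ennreal_ofReal
  rw [expMeasure, gammaMeasure, withDensity_apply_eq_zero hm] at h
  rw [Measure.restrict_apply hA]
  refine measure_mono_null (t := {x | gammaPDF 1 r x ≠ 0} ∩ A) (fun s hs => ⟨?_, hs.1⟩) h
  have := gammaPDFReal_pos one_pos hr hs.2
  simpa [gammaPDF] using this

theorem ae_nonneg_expMeasure (r : ℝ) : ∀ᵐ s ∂expMeasure r, 0 ≤ s := by
  rw [ae_iff]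
  simp only [not_le]
  change expMeasure r (Iio 0) = 0
  rw [expMeasure, gammaMeasure, withDensity_apply _ measurableSet_Iio]
  exact lintegral_gammaPDF_of_nonpos le_rfl

theorem ae_chain_nonneg (i : Fin k) : ∀ᵐ w ∂law.chain i, ∀ l, 0 ≤ (w l).2 := by
  refine ae_all_iff.2 fun l => ?_
  have hm : ∀ l, MeasurableSet {w : ℕ → Fin k × ℝ | 0 ≤ (w l).2} := fun l =>
    measurableSet_le measurable_const (by fun_prop)
  induction l generalizing i with
  | zero =>
    rw [ae_chain_iff law i (hm 0)]
    intro j _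
    filter_upwards [ae_nonneg_expMeasure (law.rate i)] with s hs
    exact ae_of_all _ fun _ => hs
  | succ l ih =>
    rw [ae_chain_iff law i (hm (l + 1))]
    intro j _
    exact ae_of_all _ fun s => ih j

/-- If a property holds almost surely for the chain started in `i`, then for almost every waiting
time in `i` it holds almost surely when the chain is continued from any other state. -/
theorem ae_ae_consPath (i j : Fin k) (hj : j ≠ i) {A : (ℕ → Fin k × ℝ) → Prop}
    (hA : MeasurableSet {w | A w}) (h : ∀ᵐ w ∂law.chain i, A w) :
    ∀ᵐ s ∂volume.restrict (Ioi (0 : ℝ)), ∀ᵐ w ∂law.chain j, A (consPath ((i, s), w)) :=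
  (expMeasure_restrict_Ioi (law.rate_pos i)).ae_le ((ae_chain_iff law i hA).1 h j hj)

end Chain

/-! ### Smooth dependence of solutions of differential equations on time and initial value -/

section Nemytskii

universe u v

variable {K : Type v} [TopologicalSpace K] [CompactSpace K]
  {E : Type u} [NormedAddCommGroup E] [NormedSpace ℝ E]

/-- Pointwise evaluation of a family of linear maps, as a bounded bilinear map. -/
noncomputable def pointwiseEval (K : Type v) [TopologicalSpace K] [CompactSpace K]
    (E : Type u) [NormedAddCommGroup E] [NormedSpace ℝ E]
    (F : Type u) [NormedAddCommGroup F] [NormedSpace ℝ F] :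
    C(K, E →L[ℝ] F) →L[ℝ] C(K, E) →L[ℝ] C(K, F) :=
  LinearMap.mkContinuous₂
    (LinearMap.mk₂ ℝ (fun (A : C(K, E →L[ℝ] F)) (h : C(K, E)) =>
        (⟨fun s => A s (h s), A.continuous.clm_apply h.continuous⟩ : C(K, F)))
      (fun _ _ _ => by ext; simp) (fun _ _ _ => by ext; simp)
      (fun _ _ _ => by ext; simp) (fun _ _ _ => by ext; simp)) 1
    (fun A h => by
      refine (ContinuousMap.norm_le _ (by positivity)).2 fun s => ?_
      refine ((A s).le_opNorm _).trans ?_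
      rw [one_mul]
      gcongr
      · exact A.norm_coe_le_norm s
      · exact h.norm_coe_le_norm s)

/-- The mean value inequality on each segment from `γ s` to `γ s + h s`. The estimate is uniform in
`s` because `γ ↦ V' ∘ γ` is continuous for the sup norm. -/
theorem hasFDerivAt_comp_continuousMap {F : Type u} [NormedAddCommGroup F] [NormedSpace ℝ F]
    (V : C(E, F)) (V' : C(E, E →L[ℝ] F)) (hV : ∀ x, HasFDerivAt V (V' x) x) (γ : C(K, E)) :
    HasFDerivAt (fun γ : C(K, E) => V.comp γ) (pointwiseEval K E F (V'.comp γ)) γ := by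
  rw [hasFDerivAt_iff_isLittleO_nhds_zero, Asymptotics.isLittleO_iff]
  intro c hc
  have hcont : Continuous fun γ : C(K, E) => V'.comp γ := ContinuousMap.continuous_postcomp V'
  obtain ⟨δ, hδ, hball⟩ := Metric.continuousAt_iff (α := C(K, E)) (β := C(K, E →L[ℝ] F)) |>.1
    (hcont.continuousAt (x := γ)) c hc
  filter_upwards [Metric.ball_mem_nhds (0 : C(K, E)) hδ] with h hh
  rw [mem_ball_zero_iff] at hh
  refine (ContinuousMap.norm_le _ (by positivity)).2 fun s => ?_
  have hseg : ∀ y ∈ segment ℝ (γ s) (γ s + h s), ‖V' y - V' (γ s)‖ ≤ c := by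
    intro y hy
    rw [segment_eq_image'] at hy
    obtain ⟨θ, hθ, rfl⟩ := hy
    have h1 : dist (γ + θ • h) γ < δ := by
      rw [dist_eq_norm, add_sub_cancel_left, norm_smul, Real.norm_of_nonneg hθ.1]
      nlinarith [norm_nonneg h, hθ.2]
    have h2 := ContinuousMap.dist_lt_iff hc |>.1 (hball h1) s
    rw [dist_eq_norm] at h2
    simpa using h2.le
  have := (convex_segment (γ s) (γ s + h s)).norm_image_sub_le_of_norm_hasFDerivWithin_le'
    (f := V) (f' := V') (φ := V' (γ s)) (fun y _ => (hV y).hasFDerivWithinAt) hseg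
    (left_mem_segment ℝ _ _) (right_mem_segment ℝ _ _)
  rw [add_sub_cancel_left] at this
  refine le_trans this ?_
  gcongr
  exact h.norm_coe_le_norm s

/-- The derivative is again a superposition operator, that of `fderiv ℝ V`, followed by a bounded
linear map. Hence an induction in which the target space `F` varies. -/
theorem contDiff_comp_continuousMap (n : ℕ) :
    ∀ {F : Type u} [NormedAddCommGroup F] [NormedSpace ℝ F] (V : C(E, F)), ContDiff ℝ n V →
      ContDiff ℝ n (fun γ : C(K, E) => V.comp γ) := by
  induction n with
  | zero =>
    intro F _ _ V _
    exact contDiff_zero.2 (ContinuousMap.continuous_postcomp V)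
  | succ n ih =>
    intro F _ _ V hV
    have h1 : Differentiable ℝ V := hV.differentiable (by simp)
    have hV' : ContDiff ℝ n (fderiv ℝ V) := hV.fderiv_right (by simp)
    set V' : C(E, E →L[ℝ] F) := ⟨fderiv ℝ V, hV'.continuous⟩
    refine contDiff_succ_iff_hasFDerivAt.2
      ⟨fun γ => pointwiseEval K E F (V'.comp γ), ?_, fun γ =>
        hasFDerivAt_comp_continuousMap V V' (fun x => (h1 x).hasFDerivAt) γ⟩
    exact (pointwiseEval K E F).contDiff.comp (ih V' hV')

end Nemytskii

/-! ### The integral equation of an ordinary differential equation, and local flows -/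

section Primitive

theorem continuous_comp_projIcc {E : Type*} [NormedAddCommGroup E]
    (γ : C(Icc (0 : ℝ) 1, E)) :
    Continuous fun r => γ (projIcc 0 1 zero_le_one r) := γ.continuous.comp continuous_projIcc

/-- Integration from `0`, as a bounded operator on continuous paths. -/
noncomputable def primitive (E : Type*) [NormedAddCommGroup E] [NormedSpace ℝ E]
    [CompleteSpace E] : C(Icc (0 : ℝ) 1, E) →L[ℝ] C(Icc (0 : ℝ) 1, E) :=
  LinearMap.mkContinuous
    { toFun := fun γ => ⟨fun s => ∫ r in (0 : ℝ)..s, γ (projIcc 0 1 zero_le_one r),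
        (intervalIntegral.continuous_primitive (fun a b =>
          (continuous_comp_projIcc γ).intervalIntegrable a b) 0).comp continuous_subtype_val⟩
      map_add' := fun γ δ => by
        ext s
        exact intervalIntegral.integral_add ((continuous_comp_projIcc γ).intervalIntegrable _ _)
          ((continuous_comp_projIcc δ).intervalIntegrable _ _)
      map_smul' := fun c γ => by
        ext s
        exact intervalIntegral.integral_smul c _ } 1
    (fun γ => by
      refine (ContinuousMap.norm_le _ (by positivity)).2 fun s => ?_
      have := intervalIntegral.norm_integral_le_of_norm_le_const (a := 0) (b := (s : ℝ))
        (f := fun r => γ (projIcc 0 1 zero_le_one r)) (C := ‖γ‖)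
        (fun r _ => γ.norm_coe_le_norm _)
      refine this.trans ?_
      rw [sub_zero, abs_of_nonneg s.2.1, mul_comm]
      gcongr
      exact s.2.2)

variable {E : Type*} [NormedAddCommGroup E] [NormedSpace ℝ E] [CompleteSpace E]

/-- The integral equation of `γ' = τ V(γ)`, `γ(0) = x` on `[0, 1]`, as an equation `_ = 0`. -/
noncomputable def pathEquation (V : C(E, E))
    (u : (ℝ × E) × C(Icc (0 : ℝ) 1, E)) : C(Icc (0 : ℝ) 1, E) :=
  u.2 - ContinuousLinearMap.const ℝ _ u.1.2 - u.1.1 • primitive E (V.comp u.2)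

theorem pathEquation_apply (V : C(E, E)) (u : (ℝ × E) × C(Icc (0 : ℝ) 1, E))
    (s : Icc (0 : ℝ) 1) : pathEquation V u s =
      u.2 s - u.1.2 - u.1.1 • ∫ r in (0 : ℝ)..s, V (u.2 (projIcc 0 1 zero_le_one r)) := rfl

theorem contDiff_pathEquation (V : C(E, E)) (hV : ContDiff ℝ 2 V) :
    ContDiff ℝ 2 (pathEquation V) := by
  have h1 : ContDiff ℝ 2 (fun γ : C(Icc (0 : ℝ) 1, E) => V.comp γ) :=
    contDiff_comp_continuousMap 2 V hV
  have h2 : ContDiff ℝ 2 fun u : (ℝ × E) × C(Icc (0 : ℝ) 1, E) => primitive E (V.comp u.2) :=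
    (primitive E).contDiff.comp (h1.comp contDiff_snd)
  exact (contDiff_snd.sub ((ContinuousLinearMap.const ℝ _).contDiff.comp
    (contDiff_snd.comp contDiff_fst))).sub ((contDiff_fst.comp contDiff_fst).smul h2)

/-- At duration `0` the integral term disappears and the equation is affine in the path. This gives
the invertibility needed for the implicit function theorem. -/
theorem fderiv_pathEquation_inr (V : C(E, E)) (hV : ContDiff ℝ 2 V) (p : E) :
    fderiv ℝ (pathEquation V) ((0, p), ContinuousLinearMap.const ℝ _ p) ∘L
      .inr ℝ (ℝ × E) C(Icc (0 : ℝ) 1, E) = .id ℝ _ := by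
  have h1 : HasFDerivAt (pathEquation V)
      (fderiv ℝ (pathEquation V) ((0, p), ContinuousLinearMap.const ℝ _ p))
      (((0, p) : ℝ × E), ContinuousLinearMap.const ℝ (Icc (0 : ℝ) 1) p) :=
    ((contDiff_pathEquation V hV).differentiable (by simp) _).hasFDerivAt
  have h2 := h1.comp (ContinuousLinearMap.const ℝ (Icc (0 : ℝ) 1) p)
    (hasFDerivAt_prodMk_right ((0, p) : ℝ × E) (ContinuousLinearMap.const ℝ (Icc (0 : ℝ) 1) p))
  refine h2.unique ?_
  have h3 : (pathEquation V ∘ fun γ => (((0, p) : ℝ × E), γ)) = fun γ =>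
      γ - ContinuousLinearMap.const ℝ (Icc (0 : ℝ) 1) p := by
    ext γ s
    simp [pathEquation]
  rw [h3]
  exact (hasFDerivAt_id _).sub_const _

/-- The endpoint of the solution of `pathEquation` solves the differential equation. -/
theorem pathEquation_endpoint {V : C(E, E)} {ψ : ℝ × E → C(Icc (0 : ℝ) 1, E)} {x p : E}
    {ε ρ : ℝ} (hε : 0 < ε)
    (hψ : pathEquation V ((ε, x), ψ (ε, x)) = 0)
    (hρ : dist (ψ (ε, x)) (ContinuousLinearMap.const ℝ _ p) < ρ)
    (huniq : ∀ t ∈ Icc 0 ε, ∀ γ : C(Icc (0 : ℝ) 1, E),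
      dist γ (ContinuousLinearMap.const ℝ _ p) < ρ →
      pathEquation V ((t, x), γ) = 0 → ψ (t, x) = γ) :
    ψ (0, x) 1 = x ∧ ∀ t ∈ Icc 0 ε,
      HasDerivWithinAt (fun t => ψ (t, x) 1) (V (ψ (t, x) 1)) (Icc 0 ε) t := by
  set g : ℝ → E := fun r => ψ (ε, x) (projIcc 0 1 zero_le_one r) with hg
  have hgc : Continuous g := continuous_comp_projIcc _
  have hVg : Continuous fun r => V (g r) := V.continuous.comp hgc
  have hgeq : ∀ s ∈ Icc (0 : ℝ) 1, g s = x + ε • ∫ r in (0 : ℝ)..s, V (g r) := by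
    intro s hs
    have h := DFunLike.congr_fun hψ ⟨s, hs⟩
    rw [pathEquation_apply] at h
    simp only [ContinuousMap.coe_zero, Pi.zero_apply] at h
    rw [sub_sub, sub_eq_zero] at h
    rw [hg]
    simp only [projIcc_of_mem zero_le_one hs]
    exact h
  have hend : ∀ t ∈ Icc 0 ε, ψ (t, x) 1 = g (t / ε) := by
    intro t ht
    set c := t / ε with hc
    have hc0 : 0 ≤ c := div_nonneg ht.1 hε.le
    have hc1 : c ≤ 1 := (div_le_one hε).2 ht.2
    have htc : t = ε * c := by
      rw [hc]
      field_simp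
    -- Running the solution of duration `ε` only up to the fraction `c` and rescaling solves the
    -- equation of duration `t = ε * c`. By uniqueness it is `ψ (t, x)`, so the endpoints trace out
    -- a single solution as `t` varies.
    set γ : C(Icc (0 : ℝ) 1, E) := ⟨fun s => g (s * c), by fun_prop⟩ with hγ
    have hγρ : dist γ (ContinuousLinearMap.const ℝ _ p) < ρ :=
      lt_of_le_of_lt ((ContinuousMap.dist_le dist_nonneg).2 fun s =>
        ContinuousMap.dist_apply_le_dist (f := ψ (ε, x))
          (g := ContinuousLinearMap.const ℝ _ p) (projIcc 0 1 zero_le_one (s * c))) hρ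
    have hγ0 : pathEquation V ((t, x), γ) = 0 := by
      ext s
      rw [pathEquation_apply]
      simp only [ContinuousMap.coe_zero, Pi.zero_apply]
      rw [sub_sub, sub_eq_zero]
      have hs : (s : ℝ) * c ∈ Icc (0 : ℝ) 1 :=
        ⟨mul_nonneg s.2.1 hc0, mul_le_one₀ s.2.2 hc0 hc1⟩
      have h1 : ∫ r in (0 : ℝ)..s, V (γ (projIcc 0 1 zero_le_one r)) =
          ∫ r in (0 : ℝ)..s, V (g (r * c)) := by
        refine intervalIntegral.integral_congr fun r hr => ?_
        rw [uIcc_of_le s.2.1] at hr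
        have hr' : r ∈ Icc (0 : ℝ) 1 := ⟨hr.1, hr.2.trans s.2.2⟩
        simp only [projIcc_of_mem zero_le_one hr', hγ, ContinuousMap.coe_mk]
      change g (s * c) = _
      rw [h1, hgeq _ hs, htc, mul_smul,
        intervalIntegral.smul_integral_comp_mul_right (fun r => V (g r)), zero_mul]
    rw [huniq t ht γ hγρ hγ0]
    simp [hγ]
  have h0 : (0 : ℝ) ∈ Icc 0 ε := ⟨le_rfl, hε.le⟩
  refine ⟨?_, fun t ht => ?_⟩
  · rw [hend 0 h0, zero_div, hgeq 0 ⟨le_rfl, zero_le_one⟩]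
    simp
  · have hF : HasDerivAt (fun t => x + ε • ∫ r in (0 : ℝ)..t / ε, V (g r)) (V (g (t / ε))) t := by
      have h1 : HasDerivAt (fun c => ∫ r in (0 : ℝ)..c, V (g r)) (V (g (t / ε))) (t / ε) :=
        intervalIntegral.integral_hasDerivAt_right (hVg.intervalIntegrable _ _)
          (hVg.stronglyMeasurableAtFilter _ _) hVg.continuousAt
      have h2 : HasDerivAt (fun t : ℝ => t / ε) (1 / ε) t := (hasDerivAt_id t).div_const ε
      have h3 := ((h1.scomp t h2).const_smul ε).const_add x
      rw [smul_smul, mul_one_div_cancel hε.ne', one_smul] at h3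
      exact h3
    rw [hend t ht]
    refine hF.hasDerivWithinAt.congr (fun r hr => ?_) ?_
    · rw [hend r hr, hgeq _ ⟨div_nonneg hr.1 hε.le, (div_le_one hε).2 hr.2⟩]
    · rw [hend t ht, hgeq _ ⟨div_nonneg ht.1 hε.le, (div_le_one hε).2 ht.2⟩]

/-- With time rescaled to `[0, 1]` the duration becomes a parameter like the initial value. The
implicit function theorem, applied at duration `0` and the constant path `p`, gives paths that
depend on both in a `C²` way; evaluation at `1` is bounded and linear. -/
theorem exists_contDiffAt_flow {V : E → E} (hV : ContDiff ℝ 2 V) (p : E) :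
    ∃ φ : ℝ × E → E, ContDiffAt ℝ 2 φ (0, p) ∧ ∃ ε > 0, ∀ᶠ x in 𝓝 p, φ (0, x) = x ∧
      ∀ t ∈ Icc 0 ε, HasDerivWithinAt (fun t => φ (t, x)) (V (φ (t, x))) (Icc 0 ε) t := by
  set W : C(E, E) := ⟨V, hV.continuous⟩
  set c : C(Icc (0 : ℝ) 1, E) := ContinuousLinearMap.const ℝ _ p
  have hsm : ContDiffAt ℝ 2 (pathEquation W) (((0, p) : ℝ × E), c) :=
    (contDiff_pathEquation W hV).contDiffAt
  have hinv : (fderiv ℝ (pathEquation W) (((0, p) : ℝ × E), c) ∘L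
      .inr ℝ (ℝ × E) C(Icc (0 : ℝ) 1, E)).IsInvertible := by
    rw [fderiv_pathEquation_inr W hV p]
    exact ⟨.refl ℝ _, rfl⟩
  have hzero : pathEquation W (((0, p) : ℝ × E), c) = 0 := by
    ext s
    simp [pathEquation, c]
  set ψ := hsm.implicitFunction two_ne_zero hinv with hψ
  have hψsm : ContDiffAt ℝ 2 ψ (0, p) := hsm.contDiffAt_implicitFunction two_ne_zero hinv
  have hψp : ψ (0, p) = c := hsm.implicitFunction_apply_self two_ne_zero hinv
  have h1 : ∀ᶠ u in 𝓝 ((0, p) : ℝ × E), pathEquation W (u, ψ u) = 0 := by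
    simpa only [hzero] using hsm.eventually_apply_implicitFunction two_ne_zero hinv
  have h2 : ∀ᶠ v in 𝓝 (((0, p) : ℝ × E), c), pathEquation W v = 0 ↔ ψ v.1 = v.2 := by
    simpa only [hzero] using hsm.eventually_apply_eq_iff_implicitFunction two_ne_zero hinv
  obtain ⟨δ, hδ, hball⟩ := Metric.eventually_nhds_iff.1 h2
  have h3 : ∀ᶠ u in 𝓝 ((0, p) : ℝ × E), dist (ψ u) c < δ := by
    have := hψsm.continuousAt.eventually (Metric.ball_mem_nhds (ψ (0, p)) hδ)
    rwa [hψp] at this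
  obtain ⟨η, hη, hball'⟩ := Metric.eventually_nhds_iff.1 (h1.and h3)
  -- Below `η` the implicit function solves the equation and stays `δ`-close to the constant path;
  -- below `δ` it is the only solution that close.
  set ε := min δ η / 2 with hε
  have hε0 : 0 < ε := by positivity
  have hεδ : ε < δ := by
    have := min_le_left δ η
    linarith [lt_min hδ hη]
  have hεη : ε < η := by
    have := min_le_right δ η
    linarith [lt_min hδ hη]
  refine ⟨fun u => ψ u 1, ?_, ε, hε0, ?_⟩
  · exact ((ContinuousMap.evalCLM ℝ (1 : Icc (0 : ℝ) 1)).contDiff.contDiffAt).comp _ hψsm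
  · filter_upwards [Metric.ball_mem_nhds p hε0] with x hx
    rw [Metric.mem_ball] at hx
    have hd : ∀ t ∈ Icc 0 ε, dist ((t, x) : ℝ × E) (0, p) ≤ ε := fun t ht => by
      rw [Prod.dist_eq]
      refine max_le ?_ hx.le
      simpa [abs_of_nonneg ht.1] using ht.2
    have hself := hball' (lt_of_le_of_lt (hd ε ⟨hε0.le, le_rfl⟩) hεη)
    refine pathEquation_endpoint (V := W) (p := p) (ρ := δ) hε0 hself.1 hself.2
      fun t ht γ hγ h0 => ?_
    refine (hball (y := ((t, x), γ)) ?_).1 h0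
    rw [Prod.dist_eq]
    exact max_lt (lt_of_le_of_lt (hd t ht) hεδ) hγ

end Primitive

/-! ### Immersions, brackets of tangent fields, and null sets -/

section Immersion

variable {P E : Type*} [NormedAddCommGroup P] [NormedSpace ℝ P]
  [NormedAddCommGroup E] [NormedSpace ℝ E]

theorem exists_leftInverse_of_injective [FiniteDimensional ℝ E] {A : P →L[ℝ] E}
    (hA : Function.Injective A) :
    ∃ L : E →L[ℝ] P, L ∘L A = .id ℝ P := by
  obtain ⟨L, hL⟩ := (A : P →ₗ[ℝ] E).exists_leftInverse_of_injective (LinearMap.ker_eq_bot.2 hA)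
  refine ⟨LinearMap.toContinuousLinearMap L, ?_⟩
  ext x
  exact LinearMap.congr_fun hL x

theorem eventually_isUnit_comp [FiniteDimensional ℝ P] {A : P →L[ℝ] E} {L : E →L[ℝ] P}
    (hL : L ∘L A = .id ℝ P) :
    ∀ᶠ B in 𝓝 A, IsUnit (L ∘L B) := by
  have : CompleteSpace P := FiniteDimensional.complete ℝ P
  have hc : Continuous fun B : P →L[ℝ] E => L ∘L B := continuous_const.clm_comp continuous_id
  refine hc.continuousAt.eventually (Units.isOpen.mem_nhds ?_)
  change IsUnit (L ∘L A)
  rw [hL]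
  exact isUnit_one

/-- Flowing an immersed submanifold along a transversal field gives an immersed submanifold of one
dimension more. -/
theorem injective_fderiv_flow_comp {f : P → E} {θ₀ : P} (hf : ContDiffAt ℝ 2 f θ₀)
    (hinj : Function.Injective (fderiv ℝ f θ₀)) {φ : ℝ × E → E}
    (hφ : ContDiffAt ℝ 2 φ (0, f θ₀)) (hφ0 : ∀ᶠ x in 𝓝 (f θ₀), φ (0, x) = x) {v : E}
    (hv : v ∉ (fderiv ℝ f θ₀).range)
    (hφv : ∃ ε > 0, HasDerivWithinAt (fun t => φ (t, f θ₀)) v (Icc 0 ε) 0) :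
    ContDiffAt ℝ 2 (fun q : P × ℝ => φ (q.2, f q.1)) (θ₀, 0) ∧
      Function.Injective (fderiv ℝ (fun q : P × ℝ => φ (q.2, f q.1)) (θ₀, 0)) := by
  have hg : ContDiffAt ℝ 2 (fun q : P × ℝ => φ (q.2, f q.1)) (θ₀, 0) := by
    have h1 : ContDiffAt ℝ 2 (fun q : P × ℝ => (q.2, f q.1)) (θ₀, 0) :=
      contDiffAt_snd.prodMk (hf.comp (θ₀, (0 : ℝ)) contDiffAt_fst)
    exact ContDiffAt.comp (θ₀, (0 : ℝ)) (g := φ) hφ h1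
  refine ⟨hg, ?_⟩
  have hD := (hg.differentiableAt two_ne_zero).hasFDerivAt
  set D := fderiv ℝ (fun q : P × ℝ => φ (q.2, f q.1)) (θ₀, 0)
  have h1 : D ∘L .inl ℝ P ℝ = fderiv ℝ f θ₀ := by
    have h := HasFDerivAt.comp (f := fun x : P => (x, (0 : ℝ))) θ₀ hD
      (hasFDerivAt_prodMk_left θ₀ (0 : ℝ))
    rw [← h.fderiv]
    refine Filter.EventuallyEq.fderiv_eq ?_
    exact hf.continuousAt.eventually hφ0
  have h2 : D (0, 1) = v := by
    have h := (HasFDerivAt.comp (f := fun t : ℝ => (θ₀, t)) (0 : ℝ) hD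
      (hasFDerivAt_prodMk_right θ₀ (0 : ℝ))).hasDerivAt
    obtain ⟨ε, hε, hv⟩ := hφv
    -- `φ` is differentiable at time `0`, so the one-sided derivative determines the two-sided one.
    have hu : UniqueDiffWithinAt ℝ (Icc (0 : ℝ) ε) 0 :=
      (uniqueDiffOn_Icc hε) 0 ⟨le_rfl, hε.le⟩
    exact hu.eq_deriv _ (h.hasDerivWithinAt) hv
  have h3 : ∀ q : P × ℝ, D q = fderiv ℝ f θ₀ q.1 + q.2 • v := by
    rintro ⟨x, s⟩
    have : ((x, s) : P × ℝ) = (x, 0) + s • (0, 1) := by simp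
    rw [this, map_add, map_smul, h2, ← h1]
    simp
  refine (injective_iff_map_eq_zero D).2 ?_
  rintro ⟨x, s⟩ hxs
  rw [h3] at hxs
  simp only at hxs
  have hs : s = 0 := by
    by_contra hs
    refine hv ⟨-(s⁻¹ • x), ?_⟩
    have : s • v = - fderiv ℝ f θ₀ x := by
      rw [eq_neg_iff_add_eq_zero, add_comm]
      exact hxs
    change fderiv ℝ f θ₀ (-(s⁻¹ • x)) = v
    rw [map_neg, map_smul, ← smul_neg, ← this, smul_smul, inv_mul_cancel₀ hs, one_smul]
  subst hs
  rw [zero_smul, add_zero] at hxs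
  have := hinj (hxs.trans (map_zero _).symm)
  simp [this]

variable [FiniteDimensional ℝ P] [FiniteDimensional ℝ E]

theorem eventually_injective {A : P →L[ℝ] E} (hA : Function.Injective A) :
    ∀ᶠ B : P →L[ℝ] E in 𝓝 A, Function.Injective B := by
  obtain ⟨L, hL⟩ := exists_leftInverse_of_injective hA
  filter_upwards [eventually_isUnit_comp hL] with B hB
  obtain ⟨u, hu⟩ := hB
  have h1 : ∀ x, (u⁻¹ : (P →L[ℝ] P)ˣ).1 (L (B x)) = x := fun x => by
    have : (u⁻¹ : (P →L[ℝ] P)ˣ).1 * (L ∘L B) = 1 := by rw [← hu, Units.inv_mul]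
    exact DFunLike.congr_fun this x
  exact fun x y hxy => by rw [← h1 x, ← h1 y, hxy]

/-- A field that is tangent to an immersed submanifold lifts to the parameter space. -/
theorem exists_lift {f : P → E} {θ₀ : P} (hf : ContDiffAt ℝ 2 f θ₀)
    (hinj : Function.Injective (fderiv ℝ f θ₀)) {V : E → E} (hV : DifferentiableAt ℝ V (f θ₀))
    (hVt : ∀ᶠ θ in 𝓝 θ₀, V (f θ) ∈ (fderiv ℝ f θ).range) :
    ∃ a : P → P, DifferentiableAt ℝ a θ₀ ∧ ∀ᶠ θ in 𝓝 θ₀, fderiv ℝ f θ (a θ) = V (f θ) := by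
  have : CompleteSpace P := FiniteDimensional.complete ℝ P
  obtain ⟨L, hL⟩ := exists_leftInverse_of_injective hinj
  have hd : DifferentiableAt ℝ (fderiv ℝ f) θ₀ :=
    (hf.fderiv_right (m := 1) (by norm_num)).differentiableAt one_ne_zero
  have hB : DifferentiableAt ℝ (fun θ => L ∘L fderiv ℝ f θ) θ₀ :=
    (differentiableAt_const L).clm_comp hd
  have hinv : DifferentiableAt ℝ (Ring.inverse : (P →L[ℝ] P) → _) (L ∘L fderiv ℝ f θ₀) := by
    rw [hL]
    exact differentiableAt_inverse (𝕜 := ℝ) isUnit_one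
  -- With `L` a left inverse of the derivative at `θ₀`, the composition of `L` with nearby
  -- derivatives stays invertible. This formula is differentiable at `θ₀` whether or not `V` is
  -- tangent, and where `V` is tangent it recovers the preimage.
  refine ⟨fun θ => Ring.inverse (L ∘L fderiv ℝ f θ) (L (V (f θ))), ?_, ?_⟩
  · exact (hinv.comp θ₀ hB).clm_apply (L.differentiableAt.comp θ₀
      (hV.comp θ₀ (hf.differentiableAt two_ne_zero)))
  · filter_upwards [hVt, hd.continuousAt.eventually (eventually_isUnit_comp hL)] with θ hθ hu
    obtain ⟨b, hb⟩ := hθ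
    obtain ⟨u, hu⟩ := hu
    rw [← hu, Ring.inverse_unit]
    have hb' : fderiv ℝ f θ b = V (f θ) := hb
    have h1 : L (V (f θ)) = (u : P →L[ℝ] P) b := by
      rw [hu, ← hb']
      rfl
    have h2 : (u⁻¹ : (P →L[ℝ] P)ˣ).1 ((u : P →L[ℝ] P) b) = b :=
      DFunLike.congr_fun (Units.inv_mul u) b
    rw [h1, h2, hb']

/-- The bracket of two fields that are tangent to an immersed submanifold is tangent to it. -/
theorem lieBracket_mem_range {f : P → E} {θ₀ : P} (hf : ContDiffAt ℝ 2 f θ₀)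
    (hinj : Function.Injective (fderiv ℝ f θ₀)) {V W : E → E}
    (hV : DifferentiableAt ℝ V (f θ₀)) (hW : DifferentiableAt ℝ W (f θ₀))
    (hVt : ∀ᶠ θ in 𝓝 θ₀, V (f θ) ∈ (fderiv ℝ f θ).range)
    (hWt : ∀ᶠ θ in 𝓝 θ₀, W (f θ) ∈ (fderiv ℝ f θ).range) :
    VectorField.lieBracket ℝ V W (f θ₀) ∈ (fderiv ℝ f θ₀).range := by
  obtain ⟨a, ha, hfa⟩ := exists_lift hf hinj hV hVt
  obtain ⟨b, hb, hfb⟩ := exists_lift hf hinj hW hWt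
  refine ⟨VectorField.lieBracket ℝ a b θ₀, ?_⟩
  have hfd := hf.differentiableAt two_ne_zero
  -- The derivative of `f` carries the bracket of the lifts to the bracket of the fields: the second
  -- derivative terms cancel by symmetry.
  have h := VectorField.fderiv_apply_lieBracket hf (by simp) hb ha
  have h1 : fderiv ℝ (fun θ => fderiv ℝ f θ (b θ)) θ₀ = fderiv ℝ W (f θ₀) ∘L fderiv ℝ f θ₀ := by
    rw [Filter.EventuallyEq.fderiv_eq hfb]
    exact fderiv_comp θ₀ hW hfd
  have h2 : fderiv ℝ (fun θ => fderiv ℝ f θ (a θ)) θ₀ = fderiv ℝ V (f θ₀) ∘L fderiv ℝ f θ₀ := by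
    rw [Filter.EventuallyEq.fderiv_eq hfa]
    exact fderiv_comp θ₀ hV hfd
  rw [h1, h2] at h
  simp only [ContinuousLinearMap.comp_apply, hfa.self_of_nhds, hfb.self_of_nhds] at h
  rw [VectorField.lieBracket_eq]
  exact h

theorem exists_equiv_of_injective {A : E →L[ℝ] E} (hA : Function.Injective A) :
    ∃ e : E ≃L[ℝ] E, (e : E →L[ℝ] E) = A :=
  ⟨(LinearEquiv.ofInjectiveEndo (A : E →ₗ[ℝ] E) hA).toContinuousLinearEquiv, by ext; rfl⟩

variable [MeasurableSpace E] [BorelSpace E] (μ : Measure E) [μ.IsAddHaarMeasure]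

/-- Near a point where the derivative is injective, preimages of null sets are null. -/
theorem exists_nhds_preimage_null {f : E → E} {x : E} (hf : ContDiffAt ℝ 1 f x)
    (hinj : Function.Injective (fderiv ℝ f x)) :
    ∃ U ∈ 𝓝 x, ∀ N, μ N = 0 → μ (U ∩ f ⁻¹' N) = 0 := by
  have : CompleteSpace E := FiniteDimensional.complete ℝ E
  obtain ⟨e, he⟩ := exists_equiv_of_injective hinj
  have hd : HasFDerivAt f (e : E →L[ℝ] E) x := by
    rw [he]
    exact (hf.differentiableAt one_ne_zero).hasFDerivAt
  set h := hf.toOpenPartialHomeomorph f hd one_ne_zero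
  have hx : x ∈ h.source := hf.mem_toOpenPartialHomeomorph_source hd one_ne_zero
  have hg : ContDiffAt ℝ 1 h.symm (f x) := hf.to_localInverse hd one_ne_zero
  obtain ⟨T, hT, hgT⟩ : ∃ T ∈ 𝓝 (f x), ∀ y ∈ T, DifferentiableAt ℝ h.symm y := by
    exact (hg.eventually (by simp)).exists_mem.imp fun T hT =>
      ⟨hT.1, fun y hy => (hT.2 y hy).differentiableAt one_ne_zero⟩
  refine ⟨h.source ∩ f ⁻¹' T, inter_mem (h.open_source.mem_nhds hx)
    (hf.continuousAt.preimage_mem_nhds hT), fun N hN => ?_⟩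
  refine measure_mono_null (t := h.symm '' (N ∩ T)) ?_ ?_
  · rintro y ⟨⟨hy, hyT⟩, hyN⟩
    exact ⟨f y, ⟨hyN, hyT⟩, h.left_inv hy⟩
  · exact addHaar_image_eq_zero_of_differentiableOn_of_addHaar_eq_zero μ
      (fun y hy => (hgT y hy.2).differentiableWithinAt) (measure_mono_null inter_subset_left hN)

/-- The flow of a smooth field has null preimages of null sets, locally and for small times. -/
theorem exists_flow_preimage_null {φ : ℝ × E → E} {p : E} (hφ : ContDiffAt ℝ 2 φ (0, p))
    (hφ0 : ∀ᶠ x in 𝓝 p, φ (0, x) = x) :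
    ∀ᶠ q in 𝓝 ((0, p) : ℝ × E), ∃ U ∈ 𝓝 q.2, ∀ N, μ N = 0 →
      μ (U ∩ (fun x => φ (q.1, x)) ⁻¹' N) = 0 := by
  have hc : ContinuousAt (fun q => fderiv ℝ φ q ∘L .inr ℝ ℝ E) (0, p) :=
    (hφ.fderiv_right (m := 1) (by norm_num)).continuousAt.clm_comp continuousAt_const
  -- The time-zero map is the identity near `p`, so the space derivative is injective there, and
  -- hence at all nearby times and points.
  have hid : fderiv ℝ φ (0, p) ∘L .inr ℝ ℝ E = .id ℝ E := by
    have h := HasFDerivAt.comp (f := fun x => ((0 : ℝ), x)) p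
      (hφ.differentiableAt two_ne_zero).hasFDerivAt (hasFDerivAt_prodMk_right (0 : ℝ) p)
    rw [← h.fderiv]
    exact (Filter.EventuallyEq.fderiv_eq hφ0).trans fderiv_id
  have hinj : Function.Injective (fderiv ℝ φ (0, p) ∘L .inr ℝ ℝ E) := by
    rw [hid]
    exact Function.injective_id
  filter_upwards [hc.eventually (eventually_injective hinj), hφ.eventually (by simp)] with q h1 h2
  have h3 : ContDiffAt ℝ 1 (fun x => φ (q.1, x)) q.2 :=
    (ContDiffAt.comp q.2 (g := φ) (f := fun x => (q.1, x)) h2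
      (contDiffAt_const.prodMk contDiffAt_id)).of_le (by norm_num)
  refine exists_nhds_preimage_null μ h3 ?_
  have h := HasFDerivAt.comp (f := fun x => (q.1, x)) q.2
      (h2.differentiableAt two_ne_zero).hasFDerivAt (hasFDerivAt_prodMk_right q.1 q.2)
  have h4 : fderiv ℝ (fun x => φ (q.1, x)) q.2 = fderiv ℝ φ q ∘L .inr ℝ ℝ E := h.fderiv
  rw [h4]
  exact h1

/-- A local diffeomorphism carries an almost everywhere statement to an open set. -/
theorem exists_open_ae_of_injective [MeasurableSpace P] [BorelSpace P] (ν : Measure P)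
    [ν.IsAddHaarMeasure] (hdim : Module.finrank ℝ P = Module.finrank ℝ E) {f : P → E} {θ₀ : P}
    (hf : ContDiffAt ℝ 2 f θ₀) (hinj : Function.Injective (fderiv ℝ f θ₀)) {O : Set P}
    (hO : O ∈ 𝓝 θ₀) {G : E → Prop} (hG : ∀ᵐ θ ∂ν, θ ∈ O → G (f θ)) :
    ∃ W : Set E, IsOpen W ∧ W.Nonempty ∧ W ⊆ f '' O ∧ ∀ᵐ y ∂μ, y ∈ W → G y := by
  have : CompleteSpace E := FiniteDimensional.complete ℝ E
  -- A linear identification of the parameter space with `E` reduces to the inverse function theorem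
  -- on `E`; it preserves null sets, since Haar measures are mutually absolutely continuous.
  set A : E ≃L[ℝ] P := ContinuousLinearEquiv.ofFinrankEq hdim.symm
  set g : E → E := f ∘ A
  have hgd : ContDiffAt ℝ 2 g (A.symm θ₀) :=
    ContDiffAt.comp _ (by simpa using hf) A.contDiff.contDiffAt
  have hgf : fderiv ℝ g (A.symm θ₀) = fderiv ℝ f θ₀ ∘L (A : E →L[ℝ] P) := by
    rw [A.comp_right_fderiv]
    simp
  obtain ⟨e, he⟩ := exists_equiv_of_injective (A := fderiv ℝ g (A.symm θ₀)) (by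
    rw [hgf]
    exact hinj.comp A.injective)
  have hd : HasFDerivAt g (e : E →L[ℝ] E) (A.symm θ₀) := by
    rw [he]
    exact (hgd.differentiableAt two_ne_zero).hasFDerivAt
  set h := hgd.toOpenPartialHomeomorph g hd two_ne_zero
  have hx : A.symm θ₀ ∈ h.source := hgd.mem_toOpenPartialHomeomorph_source hd two_ne_zero
  obtain ⟨T, hT, hTo, hxT⟩ : ∃ T : Set E, (∀ x ∈ T, DifferentiableAt ℝ g x ∧ A x ∈ O) ∧
      IsOpen T ∧ A.symm θ₀ ∈ T := by
    refine eventually_nhds_iff.1 (((hgd.eventually (by simp)).mono fun y hy => ?_).and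
      (A.continuous.continuousAt.eventually (by simpa using hO)))
    exact ContDiffAt.differentiableAt hy two_ne_zero
  have hnull : μ (A ⁻¹' {θ | ¬ (θ ∈ O → G (f θ))}) = 0 := by
    have h1 : (μ.map A).IsAddHaarMeasure := inferInstance
    have h2 : μ.map A ≪ ν := Measure.absolutelyContinuous_isAddHaarMeasure _ _
    have h3 := h2 (ae_iff.1 hG)
    have h4 := A.toHomeomorph.toMeasurableEquiv.map_apply (μ := μ) {a | ¬(a ∈ O → G (f a))}
    exact h4.symm.trans h3
  refine ⟨h '' (h.source ∩ T), h.isOpen_image_source_inter hTo, ⟨_, mem_image_of_mem _ ⟨hx, hxT⟩⟩,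
    ?_, ?_⟩
  · rintro _ ⟨x, ⟨_, hx⟩, rfl⟩
    exact ⟨A x, (hT x hx).2, rfl⟩
  · rw [ae_iff]
    refine measure_mono_null (t := g '' (T ∩ A ⁻¹' {θ | ¬ (θ ∈ O → G (f θ))})) ?_ ?_
    · rintro y hy
      simp only [mem_ofPred_eq, Classical.not_imp] at hy
      obtain ⟨⟨x, ⟨_, hx⟩, rfl⟩, hG⟩ := hy
      exact ⟨x, ⟨hx, fun h => hG (h (hT x hx).2)⟩, rfl⟩
    · exact addHaar_image_eq_zero_of_differentiableOn_of_addHaar_eq_zero μ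
        (fun y hy => (hT y hy.1).1.differentiableWithinAt)
        (measure_mono_null inter_subset_right hnull)

end Immersion

/-! ### Vector fields in a chart -/

section LocalField

variable {n : ℕ} {M : Type*} [TopologicalSpace M] [ChartedSpace (EuclideanSpace ℝ (Fin n)) M]

/-- A vector field on `M` in the coordinates of the preferred chart at `c`. -/
noncomputable def localField (c : M) (V : Π x : M, TangentSpace (𝓡 n) x) :
    EuclideanSpace ℝ (Fin n) → EuclideanSpace ℝ (Fin n) :=
  VectorField.mpullback (𝓡 n) (𝓡 n) (chartAt (EuclideanSpace ℝ (Fin n)) c).symm V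

theorem localField_add (c : M) (V W : Π x : M, TangentSpace (𝓡 n) x) :
    localField c (V + W) = localField c V + localField c W :=
  VectorField.mpullback_add

theorem localField_smul (c : M) (a : ℝ) (V : Π x : M, TangentSpace (𝓡 n) x) :
    localField c (a • V) = a • localField c V :=
  VectorField.mpullback_const_smul

variable [IsManifold (𝓡 n) ∞ M] {V W : Π x : M, TangentSpace (𝓡 n) x} {c : M}
  {y : EuclideanSpace ℝ (Fin n)}

theorem isManifold_one (n : ℕ) (M : Type*) [TopologicalSpace M]
    [ChartedSpace (EuclideanSpace ℝ (Fin n)) M] [IsManifold (𝓡 n) ∞ M] :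
    IsManifold (𝓡 n) 1 M :=
  IsManifold.of_le (n := ∞) (by simp)

theorem isManifold_minSmoothness (n : ℕ) (M : Type*) [TopologicalSpace M]
    [ChartedSpace (EuclideanSpace ℝ (Fin n)) M] [IsManifold (𝓡 n) ∞ M] :
    IsManifold (𝓡 n) (minSmoothness ℝ 3) M :=
  IsManifold.of_le (n := ∞) (by
    rw [minSmoothness_of_isRCLikeNormedField]
    exact ENat.LEInfty.out)

theorem isInvertible_mfderiv_chartAt_symm
    (hy : y ∈ (chartAt (EuclideanSpace ℝ (Fin n)) c).target) :
    (mfderiv (𝓡 n) (𝓡 n) (chartAt (EuclideanSpace ℝ (Fin n)) c).symm y).IsInvertible := by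
  have := isManifold_one n M
  exact ⟨(mdifferentiable_chart (I := 𝓡 n) c).symm.mfderiv hy, rfl⟩

theorem mfderiv_chartAt_symm_localField
    (hy : y ∈ (chartAt (EuclideanSpace ℝ (Fin n)) c).target) :
    mfderiv (𝓡 n) (𝓡 n) (chartAt (EuclideanSpace ℝ (Fin n)) c).symm y (localField c V y) =
      V ((chartAt (EuclideanSpace ℝ (Fin n)) c).symm y) := by
  obtain ⟨e, he⟩ := isInvertible_mfderiv_chartAt_symm (c := c) hy
  unfold localField VectorField.mpullback
  rw [← he, ContinuousLinearMap.inverse_equiv]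
  exact e.apply_symm_apply _

theorem contMDiffAt_chartAt_symm
    (hy : y ∈ (chartAt (EuclideanSpace ℝ (Fin n)) c).target) :
    ContMDiffAt (𝓡 n) (𝓡 n) ∞ (chartAt (EuclideanSpace ℝ (Fin n)) c).symm y :=
  (contMDiffOn_chart_symm (I := 𝓡 n) (n := ∞)).contMDiffAt
    ((chartAt (EuclideanSpace ℝ (Fin n)) c).open_target.mem_nhds hy)

theorem contDiffAt_localField (hV : IsSmoothField V)
    (hy : y ∈ (chartAt (EuclideanSpace ℝ (Fin n)) c).target) :
    ContDiffAt ℝ ∞ (localField c V) y := by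
  have := isManifold_one n M
  have h := ContMDiffAt.mpullback_vectorField_preimage (I := 𝓡 n) (I' := 𝓡 n) (m := ∞) (n := ∞)
    (hV.contMDiffAt) (contMDiffAt_chartAt_symm hy) (isInvertible_mfderiv_chartAt_symm hy) (by simp)
  exact contMDiffAt_vectorSpace_iff_contDiffAt.1 h

theorem localField_mlieBracket (hV : IsSmoothField V) (hW : IsSmoothField W)
    (hy : y ∈ (chartAt (EuclideanSpace ℝ (Fin n)) c).target) :
    localField c (VectorField.mlieBracket (𝓡 n) V W) y =
      VectorField.lieBracket ℝ (localField c V) (localField c W) y := by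
  have := isManifold_one n M
  have := isManifold_minSmoothness n M
  have h := VectorField.mpullback_mlieBracket (I := 𝓡 n) (I' := 𝓡 n) (n := ∞)
    (V := V) (W := W) (x₀ := y) (hV.contMDiffAt.mdifferentiableAt (by simp))
    (hW.contMDiffAt.mdifferentiableAt (by simp)) (contMDiffAt_chartAt_symm (c := c) hy)
    (by rw [minSmoothness_of_isRCLikeNormedField]; exact ENat.LEInfty.out)
  refine h.trans ?_
  rw [← VectorField.mlieBracketWithin_univ, VectorField.mlieBracketWithin_eq_lieBracketWithin]
  exact congrFun (VectorField.lieBracketWithin_univ (𝕜 := ℝ) (V := localField c V)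
    (W := localField c W)) y

/-- Integral curves in a chart are integral curves on the manifold. -/
theorem hasMFDerivWithinAt_chartAt_symm_comp {γ : ℝ → EuclideanSpace ℝ (Fin n)} {s : Set ℝ}
    {t : ℝ} (ht : γ t ∈ (chartAt (EuclideanSpace ℝ (Fin n)) c).target)
    (hγ : HasDerivWithinAt γ (localField c V (γ t)) s t) :
    HasMFDerivWithinAt 𝓘(ℝ, ℝ) (𝓡 n)
      (fun t => (chartAt (EuclideanSpace ℝ (Fin n)) c).symm (γ t)) s t
      ((1 : ℝ →L[ℝ] ℝ).smulRight (V ((chartAt (EuclideanSpace ℝ (Fin n)) c).symm (γ t)))) := by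
  have h1 := ((contMDiffAt_chartAt_symm (c := c) ht).mdifferentiableAt (by simp)).hasMFDerivAt
  have h2 : HasMFDerivWithinAt 𝓘(ℝ, ℝ) (𝓡 n) γ s t
      ((1 : ℝ →L[ℝ] ℝ).smulRight (localField c V (γ t))) :=
    hγ.hasFDerivWithinAt.hasMFDerivWithinAt
  refine (h1.comp_hasMFDerivWithinAt t h2).congr_mfderiv ?_
  ext
  change mfderiv (𝓡 n) (𝓡 n) (chartAt (EuclideanSpace ℝ (Fin n)) c).symm (γ t)
    ((1 : ℝ) • localField c V (γ t)) = (1 : ℝ) • _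
  rw [one_smul, one_smul, mfderiv_chartAt_symm_localField ht]

end LocalField

/-! ### Uniqueness of forward trajectories and the semigroup property -/

section Trajectory

variable {n : ℕ} {M : Type*} [TopologicalSpace M]
  [ChartedSpace (EuclideanSpace ℝ (Fin n)) M] {V : Π x : M, TangentSpace (𝓡 n) x}

/-- Glue two trajectories that meet at time `0`. -/
theorem isMIntegralCurveOn_glue {σ γ : ℝ → M} {δ T : ℝ} (h0 : σ 0 = γ 0)
    (hσ : IsMIntegralCurveOn (I := 𝓡 n) σ V (Ioc (-δ) 0)) (hγ : IsMIntegralCurveOn γ V (Ico 0 T)) :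
    IsMIntegralCurveOn (fun t => if t < 0 then σ t else γ t) V (Ioo (-δ) T) := by
  set ρ : ℝ → M := fun t => if t < 0 then σ t else γ t with hρ
  have hneg : ∀ t ∈ Iic (0 : ℝ), ρ t = σ t := fun t ht => by
    rcases (show t ≤ 0 from ht).lt_or_eq with h | rfl
    · simp [hρ, h]
    · simp [hρ, h0]
  have hpos : ∀ t ∈ Ici (0 : ℝ), ρ t = γ t := fun t ht => by
    simp [hρ, not_lt.2 (show (0 : ℝ) ≤ t from ht)]
  have h1 : IsMIntegralCurveOn (I := 𝓡 n) ρ V (Ioc (-δ) 0) := fun t ht => by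
    have := (hσ t ht).congr_mono (fun s hs => hneg s hs.2) (hneg t ht.2) Subset.rfl
    rwa [← hneg t ht.2] at this
  have h2 : IsMIntegralCurveOn (I := 𝓡 n) ρ V (Ico 0 T) := fun t ht => by
    have := (hγ t ht).congr_mono (fun s hs => hpos s hs.1) (hpos t ht.1) Subset.rfl
    rwa [← hpos t ht.1] at this
  intro t ht
  rcases lt_trichotomy t 0 with h | rfl | h
  · refine HasMFDerivAt.hasMFDerivWithinAt ?_
    exact (h1 t ⟨ht.1, h.le⟩).hasMFDerivAt
      (mem_of_superset (Ioo_mem_nhds ht.1 h) Ioo_subset_Ioc_self)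
  · refine ((h1 0 ⟨ht.1, le_rfl⟩).union (h2 0 ⟨le_rfl, ht.2⟩)).mono fun s hs => ?_
    rcases le_total s 0 with h | h
    · exact Or.inl ⟨hs.1, h⟩
    · exact Or.inr ⟨h, hs.2⟩
  · refine HasMFDerivAt.hasMFDerivWithinAt ?_
    exact (h2 t ⟨h.le, ht.2⟩).hasMFDerivAt
      (mem_of_superset (Ioo_mem_nhds h ht.2) Ioo_subset_Ico_self)

theorem flow_of_neg (V : Π x : M, TangentSpace (𝓡 n) x) {t : ℝ} (ht : t < 0) (η : M) :
    flow V t η = η := by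
  simp [flow, not_le.2 ht]

/-- The choice inside `flow` does not depend on the time, so one trajectory supplies the values at
all nonnegative times. -/
theorem isForwardTrajectory_flow (hc : IsForwardComplete V) (η : M) :
    IsForwardTrajectory V η (fun t => flow V t η) := by
  have heq : ∀ t ∈ Ici (0 : ℝ), flow V t η = (hc η).choose t := fun t ht => by
    rw [flow, dif_pos ⟨ht, hc η⟩]
  have hsp := (hc η).choose_spec
  refine ⟨(heq 0 self_mem_Ici).trans hsp.1, fun t ht => ?_⟩
  have := (hsp.2 t ht).congr_mono heq (heq t ht) Subset.rfl
  rwa [← heq t ht] at this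

theorem flow_zero (hc : IsForwardComplete V) (η : M) : flow V 0 η = η :=
  (isForwardTrajectory_flow hc η).1

variable [T2Space M] [IsManifold (𝓡 n) ∞ M]

/-- Both curves are continued to negative times by the same local integral curve. Time `0` becomes
interior, and uniqueness on open intervals applies. -/
theorem eqOn_of_isMIntegralCurveOn_Ico (hV : IsSmoothField V) {γ₁ γ₂ : ℝ → M} {T : ℝ}
    (h₁ : IsMIntegralCurveOn (I := 𝓡 n) γ₁ V (Ico 0 T))
    (h₂ : IsMIntegralCurveOn (I := 𝓡 n) γ₂ V (Ico 0 T))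
    (h : γ₁ 0 = γ₂ 0) : EqOn γ₁ γ₂ (Ico 0 T) := by
  intro t ht
  have hT : 0 < T := lt_of_le_of_lt ht.1 ht.2
  have := isManifold_one n M
  have hV1 : ContMDiff (𝓡 n) (𝓡 n).tangent 1 (fun x => (⟨x, V x⟩ : TangentBundle (𝓡 n) M)) :=
    ContMDiff.of_le hV (by simp)
  obtain ⟨σ, hσ0, hσ⟩ := exists_isMIntegralCurveAt_of_contMDiffAt_boundaryless (t₀ := (0 : ℝ))
    (hV1.contMDiffAt (x := γ₁ 0))
  obtain ⟨δ, hδ, hball⟩ := Metric.eventually_nhds_iff_ball.1 hσ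
  have hσ' : IsMIntegralCurveOn (I := 𝓡 n) σ V (Ioc (-δ) 0) := fun t ht =>
    (hball t (by
      rw [Real.ball_eq_Ioo]
      exact ⟨by linarith [ht.1], by linarith [ht.2]⟩)).hasMFDerivWithinAt
  have g₁ := isMIntegralCurveOn_glue hσ0 hσ' h₁
  have g₂ := isMIntegralCurveOn_glue (hσ0.trans h) hσ' h₂
  have := isMIntegralCurveOn_Ioo_eqOn_of_contMDiff_boundaryless (t₀ := 0)
    ⟨by linarith, hT⟩ hV1 g₁ g₂ (by simpa using h) (x := t) ⟨by linarith [ht.1], ht.2⟩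
  simpa [not_lt.2 ht.1] using this

variable (hV : IsSmoothField V) (hc : IsForwardComplete V)
include hV hc

theorem flow_eq_of_isMIntegralCurveOn {γ : ℝ → M} {T t : ℝ}
    (hγ : IsMIntegralCurveOn (I := 𝓡 n) γ V (Ico 0 T)) (ht : t ∈ Ico 0 T) :
    flow V t (γ 0) = γ t :=
  eqOn_of_isMIntegralCurveOn_Ico hV
    ((isForwardTrajectory_flow hc (γ 0)).2.mono Ico_subset_Ici_self) hγ (flow_zero hc _) ht

theorem flow_add {s t : ℝ} (hs : 0 ≤ s) (ht : 0 ≤ t) (η : M) :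
    flow V (s + t) η = flow V s (flow V t η) := by
  have h := (isForwardTrajectory_flow hc η).2.comp_add t
  have h2 : IsMIntegralCurveOn (I := 𝓡 n) (fun s => flow V (s + t) η) V (Ico 0 (s + 1)) :=
    h.mono fun r hr => add_nonneg hr.1 ht
  have := flow_eq_of_isMIntegralCurveOn hV hc h2 (t := s) ⟨hs, by linarith⟩
  simpa using this.symm

end Trajectory

/-! ### The flow in a chart -/

section LocalFlow

variable {n : ℕ} {M : Type*} [TopologicalSpace M] [T2Space M]
  [ChartedSpace (EuclideanSpace ℝ (Fin n)) M] [IsManifold (𝓡 n) ∞ M]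
  {V : Π x : M, TangentSpace (𝓡 n) x}

/-- Smooth fields near a point can be replaced by globally smooth fields. -/
theorem exists_contDiff_eqOn_ball {E : Type*} [NormedAddCommGroup E] [InnerProductSpace ℝ E]
    {V : E → E} {T : Set E} (hT : IsOpen T)
    (hV : ∀ y ∈ T, ContDiffAt ℝ 2 V y) {p : E} (hp : p ∈ T) :
    ∃ W : E → E, ContDiff ℝ 2 W ∧ ∃ r > 0, Metric.ball p r ⊆ T ∧ EqOn W V (Metric.ball p r) := by
  obtain ⟨R, hR, hRT⟩ := Metric.isOpen_iff.1 hT p hp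
  let χ : ContDiffBump p := ⟨R / 4, R / 2, by positivity, by linarith⟩
  refine ⟨fun y => χ y • V y, contDiff_iff_contDiffAt.2 fun y => ?_, R / 4, by positivity,
    (Metric.ball_subset_ball (by linarith)).trans hRT, fun y hy => ?_⟩
  · by_cases hy : y ∈ tsupport χ
    · rw [χ.tsupport_eq] at hy
      have hyT : y ∈ T := hRT (Metric.closedBall_subset_ball (show R / 2 < R by linarith) hy)
      exact χ.contDiff.contDiffAt.smul (hV y hyT)
    · have h0 : (fun y => χ y • V y) =ᶠ[𝓝 y] fun _ => 0 := by
        filter_upwards [notMem_tsupport_iff_eventuallyEq.1 hy] with z hz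
        rw [hz]
        simp
      exact contDiffAt_const.congr_of_eventuallyEq h0
  · change χ y • V y = V y
    rw [χ.one_of_mem_closedBall (Metric.ball_subset_closedBall hy), one_smul]

/-- In a chart, for small times the flow is the restriction to nonnegative times of a smooth map. -/
theorem exists_local_flow (hV : IsSmoothField V) (hc : IsForwardComplete V) (c : M)
    {p : EuclideanSpace ℝ (Fin n)} (hp : p ∈ (chartAt (EuclideanSpace ℝ (Fin n)) c).target) :
    ∃ φ : ℝ × EuclideanSpace ℝ (Fin n) → EuclideanSpace ℝ (Fin n),
      ContDiffAt ℝ 2 φ (0, p) ∧ (∀ᶠ x in 𝓝 p, φ (0, x) = x) ∧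
      (∃ ε > 0, HasDerivWithinAt (fun t => φ (t, p)) (localField c V p) (Icc 0 ε) 0) ∧
      ∃ ε > 0, ∀ᶠ x in 𝓝 p, ∀ t ∈ Icc 0 ε,
        φ (t, x) ∈ (chartAt (EuclideanSpace ℝ (Fin n)) c).target ∧
        flow V t ((chartAt (EuclideanSpace ℝ (Fin n)) c).symm x) =
          (chartAt (EuclideanSpace ℝ (Fin n)) c).symm (φ (t, x)) := by
  set e := chartAt (EuclideanSpace ℝ (Fin n)) c
  -- The cut-off field agrees with `V` near `p`, so its short trajectories, carried to the manifold
  -- by the chart, are trajectories of `V`.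
  obtain ⟨W, hW, r, hr, hrT, hWV⟩ := exists_contDiff_eqOn_ball e.open_target
    (fun y hy => (contDiffAt_localField hV hy).of_le ENat.LEInfty.out) hp
  obtain ⟨φ, hφ, ε, hε, hφε⟩ := exists_contDiffAt_flow hW p
  have hφp : φ (0, p) = p := hφε.self_of_nhds.1
  refine ⟨φ, hφ, hφε.mono fun x hx => hx.1, ⟨ε, hε, ?_⟩, ?_⟩
  · have := hφε.self_of_nhds.2 0 ⟨le_rfl, hε.le⟩
    rwa [hφp, hWV (Metric.mem_ball_self hr)] at this
  · have hball : ∀ᶠ q in 𝓝 ((0, p) : ℝ × EuclideanSpace ℝ (Fin n)), φ q ∈ Metric.ball p r := by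
      refine hφ.continuousAt.eventually ?_
      rw [hφp]
      exact Metric.ball_mem_nhds p hr
    rw [nhds_prod_eq] at hball
    obtain ⟨pt, hpt, px, hpx, hq⟩ := eventually_prod_iff.1 hball
    obtain ⟨δ, hδ, hδt⟩ := Metric.eventually_nhds_iff.1 hpt
    set T := min ε (δ / 2) with hT
    have hT0 : 0 < T := lt_min hε (by positivity)
    -- Uniqueness is available on the half-open interval up to `T`; halving leaves a closed interval
    -- inside it.
    refine ⟨T / 2, by positivity, ?_⟩
    filter_upwards [hφε, hpx] with x hx hx'
    have hmem : ∀ t ∈ Icc 0 T, φ (t, x) ∈ Metric.ball p r := fun t ht => by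
      refine hq (hδt ?_) hx'
      rw [Real.dist_eq, sub_zero, abs_of_nonneg ht.1]
      have := min_le_right ε (δ / 2)
      linarith [ht.2]
    have hcurve : IsMIntegralCurveOn (I := 𝓡 n) (fun t => e.symm (φ (t, x))) V (Ico 0 T) := by
      intro t ht
      have htT : t ∈ Icc 0 T := Ico_subset_Icc_self ht
      have h1 := (hx.2 t ⟨ht.1, ht.2.le.trans (min_le_left _ _)⟩).mono
        (show Ico 0 T ⊆ Icc 0 ε from fun s hs => ⟨hs.1, hs.2.le.trans (min_le_left _ _)⟩)
      rw [hWV (hmem t htT)] at h1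
      exact hasMFDerivWithinAt_chartAt_symm_comp (c := c) (hrT (hmem t htT)) h1
    intro t ht
    refine ⟨hrT (hmem t ⟨ht.1, by linarith [ht.2]⟩), ?_⟩
    have := flow_eq_of_isMIntegralCurveOn hV hc hcurve (t := t) ⟨ht.1, by linarith [ht.2]⟩
    simp only [hx.1] at this
    exact this

end LocalFlow

/-! ### Null sets in charts -/

section Null

theorem measurableSet_inter_preimage_of_continuousOn {X Y : Type*}
    [TopologicalSpace X] [MeasurableSpace X] [BorelSpace X] [TopologicalSpace Y]
    [MeasurableSpace Y] [BorelSpace Y] {g : X → Y} {O : Set X} (hg : ContinuousOn g O)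
    (hO : IsOpen O) {A : Set Y} (hA : MeasurableSet A) : MeasurableSet (O ∩ g ⁻¹' A) := by
  have h2 : Measurable fun x : O => g x :=
    (continuousOn_iff_continuous_domRestrict.1 hg).measurable
  have h3 := hO.measurableSet.subtype_image (h2 hA)
  convert h3 using 1
  ext x
  simp [and_comm]

variable {n : ℕ} {M : Type*} [TopologicalSpace M] [T2Space M] [SecondCountableTopology M]
  [ChartedSpace (EuclideanSpace ℝ (Fin n)) M] [IsManifold (𝓡 n) ∞ M]
  [MeasurableSpace M] [BorelSpace M]

theorem lebesgueMeasure_source_inter_preimage_eq_zero_iff (c : M)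
    {A : Set (EuclideanSpace ℝ (Fin n))} (hA : MeasurableSet A) :
    lebesgueMeasure n M ((chartAt (EuclideanSpace ℝ (Fin n)) c).source ∩
      chartAt (EuclideanSpace ℝ (Fin n)) c ⁻¹' A) = 0 ↔
    volume ((chartAt (EuclideanSpace ℝ (Fin n)) c).target ∩ A) = 0 := by
  set e := chartAt (EuclideanSpace ℝ (Fin n)) c
  have he := IsManifold.chart_mem_maximalAtlas (I := 𝓡 n) (n := ∞) c
  have hm : AEMeasurable e ((lebesgueMeasure n M).restrict e.source) :=
    e.continuousOn.aemeasurable e.open_source.measurableSet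
  have h1 : ((lebesgueMeasure n M).restrict e.source).map e A =
      lebesgueMeasure n M (e.source ∩ e ⁻¹' A) := by
    rw [Measure.map_apply_of_aemeasurable hm hA,
      Measure.restrict_apply' e.open_source.measurableSet, inter_comm]
  have h2 : volume.restrict e.target A = volume (e.target ∩ A) := by
    rw [Measure.restrict_apply' e.open_target.measurableSet, inter_comm]
  rw [← h1, ← h2]
  exact ⟨fun h => (lebesgueMeasure_map_chart he).2 h, fun h => (lebesgueMeasure_map_chart he).1 h⟩

theorem lebesgueMeasure_source_inter_preimage_null (c : M) {A : Set (EuclideanSpace ℝ (Fin n))}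
    (hA : volume A = 0) :
    lebesgueMeasure n M ((chartAt (EuclideanSpace ℝ (Fin n)) c).source ∩
      chartAt (EuclideanSpace ℝ (Fin n)) c ⁻¹' A) = 0 := by
  refine measure_mono_null (inter_subset_inter_right _
    (preimage_mono (subset_toMeasurable volume A)))
    ((lebesgueMeasure_source_inter_preimage_eq_zero_iff c
      (measurableSet_toMeasurable volume A)).2 ?_)
  refine measure_mono_null inter_subset_right ?_
  rwa [measure_toMeasurable]

theorem volume_target_inter_preimage_symm_null (c : M) {N : Set M}
    (hN : lebesgueMeasure n M N = 0) :
    volume ((chartAt (EuclideanSpace ℝ (Fin n)) c).target ∩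
      (chartAt (EuclideanSpace ℝ (Fin n)) c).symm ⁻¹' N) = 0 := by
  set e := chartAt (EuclideanSpace ℝ (Fin n)) c
  set N' := toMeasurable (lebesgueMeasure n M) N
  have hN' : lebesgueMeasure n M N' = 0 := by rwa [measure_toMeasurable]
  have hNm : MeasurableSet N' := measurableSet_toMeasurable _ _
  have hm : MeasurableSet (e.target ∩ e.symm ⁻¹' N') :=
    measurableSet_inter_preimage_of_continuousOn e.continuousOn_symm e.open_target hNm
  have h := (lebesgueMeasure_source_inter_preimage_eq_zero_iff c hm).1 (measure_mono_null ?_ hN')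
  · refine measure_mono_null (fun y hy => ?_) h
    exact ⟨hy.1, hy.1, subset_toMeasurable _ _ hy.2⟩
  · rintro x ⟨hx, hx'⟩
    have := hx'.2
    rwa [mem_preimage, e.left_inv hx] at this

end Null

/-! ### Continuity of the flow, and preimages of null sets under the flow -/

section GlobalFlow

variable {n : ℕ} {M : Type*} [TopologicalSpace M] [T2Space M] [SecondCountableTopology M]
  [ChartedSpace (EuclideanSpace ℝ (Fin n)) M] [IsManifold (𝓡 n) ∞ M]
  [MeasurableSpace M] {V : Π x : M, TangentSpace (𝓡 n) x}

/-- Up to time `T` the flow is continuous near `x`, and has null preimages of null sets. -/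
def IsRegularUpTo (V : Π x : M, TangentSpace (𝓡 n) x) (T : ℝ) (x : M) : Prop :=
  ∃ U ∈ 𝓝 x, ContinuousOn (fun q : ℝ × M => flow V q.1 q.2) (Icc 0 T ×ˢ U) ∧
    ∀ t ∈ Icc 0 T, ∀ N, lebesgueMeasure n M N = 0 →
      lebesgueMeasure n M (U ∩ {y | flow V t y ∈ N}) = 0

theorem IsRegularUpTo.mono {S T : ℝ} {x : M} (h : IsRegularUpTo V T x) (hST : S ≤ T) :
    IsRegularUpTo V S x := by
  obtain ⟨U, hU, hc, hN⟩ := h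
  exact ⟨U, hU, hc.mono (prod_mono_left (Icc_subset_Icc_right hST)),
    fun t ht => hN t ⟨ht.1, ht.2.trans hST⟩⟩

variable (hV : IsSmoothField V) (hc : IsForwardComplete V)
include hV hc

/-- After time `T` the flow factors, by the semigroup property, through its time-`T` map into the
neighbourhood of `flow V T x`. -/
theorem IsRegularUpTo.add {S T : ℝ} {x : M} (hS0 : 0 ≤ S) (hT0 : 0 ≤ T) (hT : IsRegularUpTo V T x)
    (hS : IsRegularUpTo V S (flow V T x)) : IsRegularUpTo V (S + T) x := by
  obtain ⟨U, hU, hUc, hUN⟩ := hT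
  obtain ⟨U', hU', hUc', hUN'⟩ := hS
  have hx : x ∈ U := mem_of_mem_nhds hU
  have hflow : ContinuousOn (fun y => flow V T y) U :=
    hUc.comp (f := fun y => (T, y)) (by fun_prop) fun y hy => ⟨⟨hT0, le_rfl⟩, hy⟩
  have hmem : {y | flow V T y ∈ U'} ∈ 𝓝 x := (hflow.continuousAt hU).preimage_mem_nhds hU'
  refine ⟨U ∩ {y | flow V T y ∈ U'}, inter_mem hU hmem, ?_, ?_⟩
  · have hsplit : Icc (0 : ℝ) (S + T) ×ˢ (U ∩ {y | flow V T y ∈ U'}) =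
        (Icc 0 T ×ˢ (U ∩ {y | flow V T y ∈ U'})) ∪
        (Icc T (S + T) ×ˢ (U ∩ {y | flow V T y ∈ U'})) := by
      rw [← union_prod, Icc_union_Icc_eq_Icc hT0 (by linarith)]
    have hcl : ∀ A : Set ℝ, IsClosed A → ∀ s : Set M, ∀ q ∈ (univ ×ˢ s : Set (ℝ × M)),
        q ∉ A ×ˢ s → (A ×ˢ s)ᶜ ∈ 𝓝[univ ×ˢ s] q := by
      rintro A hA s q hq hqA
      have h1 : q.1 ∉ A := fun h => hqA ⟨h, hq.2⟩
      have h2 : {q' : ℝ × M | q'.1 ∉ A} ∈ 𝓝 q :=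
        continuous_fst.continuousAt.preimage_mem_nhds (hA.isOpen_compl.mem_nhds h1)
      exact mem_nhdsWithin_of_mem_nhds (mem_of_superset h2 fun q' h h' => h h'.1)
    rw [hsplit]
    have h1 : ContinuousOn (fun q : ℝ × M => flow V q.1 q.2)
        (Icc 0 T ×ˢ (U ∩ {y | flow V T y ∈ U'})) := hUc.mono (prod_mono_right inter_subset_left)
    have h2 : ContinuousOn (fun q : ℝ × M => flow V q.1 q.2)
        (Icc T (S + T) ×ˢ (U ∩ {y | flow V T y ∈ U'})) := by
      have : ContinuousOn (fun q : ℝ × M => flow V (q.1 - T) (flow V T q.2))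
          (Icc T (S + T) ×ˢ (U ∩ {y | flow V T y ∈ U'})) := by
        refine hUc'.comp (f := fun q : ℝ × M => (q.1 - T, flow V T q.2)) ?_ ?_
        · exact (by fun_prop : Continuous fun q : ℝ × M => q.1 - T).continuousOn.prodMk
            (hflow.comp continuousOn_snd fun q hq => hq.2.1)
        · rintro q ⟨hq1, hq2⟩
          exact ⟨⟨by linarith [hq1.1], by linarith [hq1.2]⟩, hq2.2⟩
      refine this.congr fun q hq => ?_
      have := flow_add hV hc (s := q.1 - T) (by linarith [hq.1.1]) hT0 q.2
      rw [sub_add_cancel] at this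
      exact this
    intro q hq
    have hqs : q ∈ (univ ×ˢ (U ∩ {y | flow V T y ∈ U'}) : Set (ℝ × M)) := by
      rcases hq with hq | hq <;> exact ⟨trivial, hq.2⟩
    -- The two time pieces are closed. At a point outside a piece, continuity within that piece is
    -- vacuous, so continuity glues.
    have key : ∀ A : Set ℝ, IsClosed A → ContinuousOn (fun q : ℝ × M => flow V q.1 q.2)
        (A ×ˢ (U ∩ {y | flow V T y ∈ U'})) →
        ContinuousWithinAt (fun q : ℝ × M => flow V q.1 q.2)
          (A ×ˢ (U ∩ {y | flow V T y ∈ U'})) q := by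
      intro A hA hcont
      by_cases hqA : q ∈ A ×ˢ (U ∩ {y | flow V T y ∈ U'})
      · exact hcont q hqA
      · have h := hcl A hA _ q hqs hqA
        have h3 : 𝓝[A ×ˢ (U ∩ {y | flow V T y ∈ U'})] q = ⊥ := by
          rw [← empty_mem_iff_bot]
          have h4 := nhdsWithin_mono q (prod_mono_left (subset_univ A)) h
          have h5 : A ×ˢ (U ∩ {y | flow V T y ∈ U'}) ∈
            𝓝[A ×ˢ (U ∩ {y | flow V T y ∈ U'})] q := self_mem_nhdsWithin
          simpa using inter_mem h4 h5
        rw [ContinuousWithinAt, h3]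
        exact tendsto_bot
    exact (key _ isClosed_Icc h1).union (key _ isClosed_Icc h2)
  · intro t ht N hN
    rcases le_total t T with htT | htT
    · exact measure_mono_null (inter_subset_inter_left _ inter_subset_left) (hUN t ⟨ht.1, htT⟩ N hN)
    · have h1 := hUN' (t - T) ⟨by linarith, by linarith [ht.2]⟩ N hN
      have h2 := hUN T ⟨hT0, le_rfl⟩ _ h1
      refine measure_mono_null ?_ h2
      rintro y ⟨⟨hyU, hyU'⟩, hyN⟩
      refine ⟨hyU, hyU', ?_⟩
      have := flow_add hV hc (s := t - T) (by linarith) hT0 y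
      rw [sub_add_cancel] at this
      change flow V (t - T) (flow V T y) ∈ N
      rw [← this]
      exact hyN

variable [BorelSpace M]

/-- Transfer of the local flow through a chart. The same `ε` serves all points near `x`, which is
what the compactness argument of `isRegularUpTo` needs. -/
theorem exists_isRegularUpTo (x : M) : ∃ ε > 0, ∀ᶠ y in 𝓝 x, IsRegularUpTo V ε y := by
  set e := chartAt (EuclideanSpace ℝ (Fin n)) x
  set p := e x
  have hx : x ∈ e.source := mem_chart_source _ x
  obtain ⟨φ, hφ, hφ0, -, ε₁, hε₁, hflow⟩ := exists_local_flow hV hc x (e.map_source hx)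
  have h1 := (exists_flow_preimage_null (volume : Measure (EuclideanSpace ℝ (Fin n))) hφ hφ0).and
    ((hφ.eventually (by simp)))
  rw [nhds_prod_eq] at h1
  obtain ⟨pt, hpt, px, hpx, hq⟩ := eventually_prod_iff.1 h1
  obtain ⟨δ, hδ, hδt⟩ := Metric.eventually_nhds_iff.1 hpt
  obtain ⟨B, hB, hBo, hpB⟩ := eventually_nhds_iff.1 ((hflow.and hpx).and
    (e.open_target.mem_nhds (e.map_source hx)))
  set ε := min ε₁ (δ / 2) with hε
  have hε0 : 0 < ε := lt_min hε₁ (by positivity)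
  have hεt : ∀ t ∈ Icc 0 ε, t ∈ Icc 0 ε₁ ∧ pt t := fun t ht => by
    refine ⟨⟨ht.1, ht.2.trans (min_le_left _ _)⟩, hδt ?_⟩
    rw [Real.dist_eq, sub_zero, abs_of_nonneg ht.1]
    have := min_le_right ε₁ (δ / 2)
    linarith [ht.2]
  set U := e.source ∩ e ⁻¹' B with hU
  have hUo : IsOpen U := e.isOpen_inter_preimage hBo
  have hUflow : ∀ t ∈ Icc 0 ε, ∀ y ∈ U, φ (t, e y) ∈ e.target ∧
      flow V t y = e.symm (φ (t, e y)) := fun t ht y hy => by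
    have := (hB (e y) hy.2).1.1 t (hεt t ht).1
    rwa [e.left_inv hy.1] at this
  refine ⟨ε, hε0, ?_⟩
  filter_upwards [hUo.mem_nhds ⟨hx, hpB⟩] with x' hx'
  refine ⟨U, hUo.mem_nhds hx', ?_, ?_⟩
  · have h2 : ContinuousOn (fun q : ℝ × M => e.symm (φ (q.1, e q.2))) (Icc 0 ε ×ˢ U) := by
      have h3 : ContinuousOn (fun q : ℝ × M => (q.1, e q.2)) (Icc 0 ε ×ˢ U) :=
        continuousOn_fst.prodMk (e.continuousOn.comp continuousOn_snd fun q hq => hq.2.1)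
      have h4 : ContinuousOn (fun q : ℝ × M => φ (q.1, e q.2)) (Icc 0 ε ×ˢ U) := by
        intro q hq'
        have h5 := (hq (hεt q.1 hq'.1).2 (hB (e q.2) hq'.2.2).1.2).2
        exact ContinuousAt.comp_continuousWithinAt (g := φ) h5.continuousAt (h3 q hq')
      exact e.continuousOn_symm.comp h4 fun q hq' => (hUflow q.1 hq'.1 q.2 hq'.2).1
    exact h2.congr fun q hq' => (hUflow q.1 hq'.1 q.2 hq'.2).2
  · intro t ht N hN
    set N' := e.target ∩ e.symm ⁻¹' N
    have hN' : volume N' = 0 := volume_target_inter_preimage_symm_null x hN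
    have hnull : volume (B ∩ (fun y => φ (t, y)) ⁻¹' N') = 0 := by
      refine measure_null_of_locally_null _ fun y hy => ?_
      obtain ⟨T, hT, hTN⟩ := (hq (hεt t ht).2 (hB y hy.1).1.2).1
      exact ⟨_, inter_mem (mem_nhdsWithin_of_mem_nhds hT)
        (mem_of_superset self_mem_nhdsWithin inter_subset_right), hTN N' hN'⟩
    refine measure_mono_null ?_ (lebesgueMeasure_source_inter_preimage_null x hnull)
    rintro y ⟨hyU, hyN⟩
    have := hUflow t ht y hyU
    refine ⟨hyU.1, hyU.2, this.1, ?_⟩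
    rw [mem_preimage, ← this.2]
    exact hyN

/-- A trajectory segment is compact, so one step length `ε` works at all of its points, and finitely
many steps reach `T`. -/
theorem isRegularUpTo (T : ℝ) (x : M) : IsRegularUpTo V T x := by
  rcases lt_or_ge T 0 with hT | hT
  · obtain ⟨ε, hε, h⟩ := exists_isRegularUpTo hV hc x
    exact h.self_of_nhds.mono (by linarith)
  set K := (fun t => flow V t x) '' Icc 0 T with hK
  have hKc : IsCompact K := isCompact_Icc.image_of_continuousOn
    ((isForwardTrajectory_flow hc x).2.continuousOn.mono Icc_subset_Ici_self)
  obtain ⟨ε, hε, hεK⟩ : ∃ ε > 0, ∀ y ∈ K, IsRegularUpTo V ε y := by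
    refine hKc.induction_on (p := fun s => ∃ ε > 0, ∀ y ∈ s, IsRegularUpTo V ε y)
      ⟨1, one_pos, by simp⟩ ?_ ?_ ?_
    · rintro s t hst ⟨ε, hε, h⟩
      exact ⟨ε, hε, fun y hy => h y (hst hy)⟩
    · rintro s t ⟨ε, hε, h⟩ ⟨ε', hε', h'⟩
      refine ⟨min ε ε', lt_min hε hε', fun y hy => ?_⟩
      rcases hy with hy | hy
      · exact (h y hy).mono (min_le_left _ _)
      · exact (h' y hy).mono (min_le_right _ _)
    · intro y _
      obtain ⟨ε, hε, h⟩ := exists_isRegularUpTo hV hc y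
      exact ⟨_, mem_nhdsWithin_of_mem_nhds h, ε, hε, fun z hz => hz⟩
  have hstep : ∀ m : ℕ, IsRegularUpTo V (min (m * ε) T) x := by
    intro m
    induction m with
    | zero =>
      have := hεK x ⟨0, ⟨le_rfl, hT⟩, flow_zero hc x⟩
      exact this.mono (by simpa using Or.inl hε.le)
    | succ m ih =>
      have h0 : 0 ≤ min (m * ε) T := le_min (by positivity) hT
      have h1 := hεK _ ⟨min (m * ε) T, ⟨h0, min_le_right _ _⟩, rfl⟩
      refine (IsRegularUpTo.add hV hc hε.le h0 ih h1).mono ?_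
      push_cast
      rcases le_total (m * ε) T with h | h
      · rw [min_eq_left h]
        exact (min_le_left _ _).trans (by linarith)
      · rw [min_eq_right h]
        exact (min_le_right _ _).trans (by linarith)
  obtain ⟨m, hm⟩ := exists_nat_ge (T / ε)
  have := hstep m
  rwa [min_eq_right ((div_le_iff₀ hε).1 hm)] at this

theorem continuousOn_flow :
    ContinuousOn (fun q : ℝ × M => flow V q.1 q.2) (Ici 0 ×ˢ univ) := by
  rintro ⟨t, x⟩ ⟨ht, -⟩
  obtain ⟨U, hU, hUc, -⟩ := isRegularUpTo hV hc (t + 1) x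
  refine (hUc (t, x) ⟨⟨ht, by simp⟩, mem_of_mem_nhds hU⟩).mono_of_mem_nhdsWithin ?_
  have h1 : (Iio (t + 1) ×ˢ U : Set (ℝ × M)) ∈ 𝓝 (t, x) :=
    prod_mem_nhds (Iio_mem_nhds (by linarith)) hU
  filter_upwards [self_mem_nhdsWithin, mem_nhdsWithin_of_mem_nhds h1] with q hq hq'
  exact ⟨⟨hq.1, hq'.1.le⟩, hq'.2⟩

theorem measurable_flow : Measurable fun q : ℝ × M => flow V q.1 q.2 := by
  classical
  have hs : MeasurableSet (Ici (0 : ℝ) ×ˢ (univ : Set M)) := measurableSet_Ici.prod .univ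
  have h2 : ContinuousOn (fun q : ℝ × M => q.2) (Ici (0 : ℝ) ×ˢ (univ : Set M))ᶜ :=
    continuousOn_snd
  have := (continuousOn_flow hV hc).measurable_piecewise h2 hs
  convert this using 1
  ext q
  by_cases hq : q ∈ Ici (0 : ℝ) ×ˢ (univ : Set M)
  · rw [piecewise_eq_of_mem _ _ _ hq]
  · rw [piecewise_eq_of_notMem _ _ _ hq]
    exact flow_of_neg V (by simpa using hq) q.2

/-- Preimages of Lebesgue null sets under the flow are null. -/
theorem lebesgueMeasure_flow_preimage (t : ℝ) {N : Set M} (hN : lebesgueMeasure n M N = 0) :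
    lebesgueMeasure n M {y | flow V t y ∈ N} = 0 := by
  rcases lt_or_ge t 0 with ht | ht
  · simp only [flow_of_neg V ht]
    exact hN
  · refine measure_null_of_locally_null _ fun x _ => ?_
    obtain ⟨U, hU, -, hUN⟩ := isRegularUpTo hV hc t x
    exact ⟨_, inter_mem (mem_nhdsWithin_of_mem_nhds hU) self_mem_nhdsWithin,
      hUN t ⟨ht, le_rfl⟩ N hN⟩

end GlobalFlow

/-! ### Measurability of the switching process -/

section Measurability

variable {k : ℕ}

theorem measurable_switchTime (m : ℕ) :
    Measurable fun w : ℕ → Fin k × ℝ => switchTime w m := by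
  unfold switchTime
  fun_prop

/-- Only positive values are characterised: `sSup` in `ℕ` is also `0` on empty and on unbounded
sets. -/
theorem switchCount_eq_succ_iff (w : ℕ → Fin k × ℝ) (t : ℝ) (m : ℕ) :
    switchCount w t = m + 1 ↔ switchTime w (m + 1) ≤ t ∧ ∀ l > m + 1, t < switchTime w l := by
  constructor
  · intro h
    have hb : BddAbove {m | switchTime w m ≤ t} := by
      by_contra hb
      have := Nat.sSup_of_not_bddAbove hb
      rw [switchCount] at h
      omega
    have hne : {m | switchTime w m ≤ t}.Nonempty := by
      by_contra hne
      rw [not_nonempty_iff_eq_empty] at hne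
      rw [switchCount, hne, csSup_empty] at h
      exact absurd h (by simp)
    have hmem := Nat.sSup_mem hne hb
    rw [switchCount] at h
    rw [h] at hmem
    refine ⟨hmem, fun l hl => ?_⟩
    by_contra hlt
    have := le_csSup hb (show l ∈ {m | switchTime w m ≤ t} from not_lt.1 hlt)
    omega
  · rintro ⟨h1, h2⟩
    refine IsGreatest.csSup_eq ⟨h1, fun l hl => ?_⟩
    by_contra hlt
    exact absurd (h2 l (not_le.1 hlt)) (not_lt.2 hl)

theorem measurable_switchCount :
    Measurable fun q : (ℕ → Fin k × ℝ) × ℝ => switchCount q.1 q.2 := by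
  have hsucc : ∀ m, MeasurableSet
      ((fun q : (ℕ → Fin k × ℝ) × ℝ => switchCount q.1 q.2) ⁻¹' {m + 1}) := by
    intro m
    have : (fun q : (ℕ → Fin k × ℝ) × ℝ => switchCount q.1 q.2) ⁻¹' {m + 1} =
        {q | switchTime q.1 (m + 1) ≤ q.2} ∩ ⋂ l, ⋂ (_ : l > m + 1),
          {q | q.2 < switchTime q.1 l} := by
      ext q
      simp [switchCount_eq_succ_iff]
    rw [this]
    exact (measurableSet_le ((measurable_switchTime _).comp measurable_fst) measurable_snd).inter
      (MeasurableSet.iInter fun l => MeasurableSet.iInter fun _ =>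
        measurableSet_lt measurable_snd ((measurable_switchTime _).comp measurable_fst))
  refine measurable_to_countable' fun m => ?_
  cases m with
  | succ m => exact hsucc m
  | zero =>
    have : (fun q : (ℕ → Fin k × ℝ) × ℝ => switchCount q.1 q.2) ⁻¹' {0} =
        (⋃ m, (fun q : (ℕ → Fin k × ℝ) × ℝ => switchCount q.1 q.2) ⁻¹' {m + 1})ᶜ := by
      ext q
      simp only [mem_preimage, mem_singleton_iff, mem_compl_iff, mem_iUnion, not_exists]
      exact ⟨fun h m => by omega, fun h => by
        by_contra h0
        exact h (switchCount q.1 q.2 - 1) (by omega)⟩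
    rw [this]
    exact (MeasurableSet.iUnion hsucc).compl

variable {n : ℕ} {M : Type*} [TopologicalSpace M] [T2Space M] [SecondCountableTopology M]
  [ChartedSpace (EuclideanSpace ℝ (Fin n)) M] [IsManifold (𝓡 n) ∞ M]
  [MeasurableSpace M] [BorelSpace M]
  {u : Fin k → Π x : M, TangentSpace (𝓡 n) x}
  (hu : ∀ i, IsSmoothField (u i)) (hc : ∀ i, IsForwardComplete (u i))
include hu hc

theorem measurable_flow_index :
    Measurable fun q : Fin k × ℝ × M => flow (u q.1) q.2.1 q.2.2 :=
  measurable_from_prod_countable_right fun i => measurable_flow (hu i) (hc i)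

theorem measurable_switchPosition (m : ℕ) :
    Measurable fun q : (ℕ → Fin k × ℝ) × M => switchPosition u q.1 q.2 m := by
  induction m with
  | zero => exact measurable_snd
  | succ m ih =>
    have h : Measurable fun q : (ℕ → Fin k × ℝ) × M =>
        ((q.1 m).1, (q.1 m).2, switchPosition u q.1 q.2 m) :=
      Measurable.prodMk (by fun_prop) (Measurable.prodMk (by fun_prop) ih)
    exact (measurable_flow_index hu hc).comp h

/-- For a fixed number of switches the formula is measurable, and that number is a measurable
function with countable range. -/
theorem measurable_processAt :
    Measurable fun q : (ℕ → Fin k × ℝ) × M × ℝ => processAt u q.1 q.2.1 q.2.2 := by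
  have h1 : Measurable fun p : ℕ × (ℕ → Fin k × ℝ) × M × ℝ =>
      (flow (u (p.2.1 p.1).1) (p.2.2.2 - switchTime p.2.1 p.1)
        (switchPosition u p.2.1 p.2.2.1 p.1), (p.2.1 p.1).1) := by
    refine measurable_from_prod_countable_right fun m => Measurable.prodMk ?_
      (by fun_prop : Measurable fun q : (ℕ → Fin k × ℝ) × M × ℝ => (q.1 m).1)
    have hpos : Measurable fun q : (ℕ → Fin k × ℝ) × M × ℝ => switchPosition u q.1 q.2.1 m :=
      (measurable_switchPosition hu hc m).comp (by fun_prop : Measurable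
        fun q : (ℕ → Fin k × ℝ) × M × ℝ => (q.1, q.2.1))
    have htime : Measurable fun q : (ℕ → Fin k × ℝ) × M × ℝ => q.2.2 - switchTime q.1 m :=
      (by fun_prop : Measurable fun q : (ℕ → Fin k × ℝ) × M × ℝ => q.2.2).sub
        ((measurable_switchTime m).comp measurable_fst)
    have h : Measurable fun q : (ℕ → Fin k × ℝ) × M × ℝ =>
        ((q.1 m).1, q.2.2 - switchTime q.1 m, switchPosition u q.1 q.2.1 m) :=
      Measurable.prodMk (by fun_prop) (htime.prodMk hpos)
    exact (measurable_flow_index hu hc).comp h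
  have h2 : Measurable fun q : (ℕ → Fin k × ℝ) × M × ℝ => (switchCount q.1 q.2.2, q) :=
    (measurable_switchCount.comp (by fun_prop : Measurable
        fun q : (ℕ → Fin k × ℝ) × M × ℝ => (q.1, q.2.2))).prodMk measurable_id
  exact h1.comp h2

theorem transition_apply (law : SwitchingLaw k) (t : ℝ) (z : M × Fin k) {N : Set (M × Fin k)}
    (hN : MeasurableSet N) :
    transition u law t z N = law.chain z.2 {w | processAt u w z.1 t ∈ N} := by
  have h : Measurable fun w : ℕ → Fin k × ℝ => processAt u w z.1 t :=
    (measurable_processAt hu hc).comp (by fun_prop : Measurable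
        fun w : ℕ → Fin k × ℝ => (w, z.1, t))
  exact Measure.map_apply h hN

/-- For a fixed switching sequence, preimages of null sets under the process are null. -/
theorem lebesgueMeasure_processAt_preimage (w : ℕ → Fin k × ℝ) (t : ℝ) {N : Set (M × Fin k)}
    (hN : ∀ i, lebesgueMeasure n M {x | (x, i) ∈ N} = 0) :
    lebesgueMeasure n M {x | processAt u w x t ∈ N} = 0 := by
  have hpos : ∀ (m : ℕ) (N : Set M), lebesgueMeasure n M N = 0 →
      lebesgueMeasure n M {x | switchPosition u w x m ∈ N} = 0 := by
    intro m
    induction m with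
    | zero => exact fun N hN => hN
    | succ m ih => exact fun N hN => ih _ (lebesgueMeasure_flow_preimage (hu _) (hc _) _ hN)
  exact hpos _ _ (lebesgueMeasure_flow_preimage (hu _) (hc _) _ (hN _))

end Measurability

/-! ### Lebesgue null sets in the product space and invariance of the singular part -/

section Singular

variable {n k : ℕ} {M : Type*} [TopologicalSpace M] [T2Space M] [SecondCountableTopology M]
  [ChartedSpace (EuclideanSpace ℝ (Fin n)) M] [IsManifold (𝓡 n) ∞ M]
  [MeasurableSpace M] [BorelSpace M]

/-- Lebesgue measure is equivalent to an s-finite measure. -/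
theorem exists_sFinite_equivalent (n : ℕ) (M : Type*) [TopologicalSpace M] [T2Space M]
    [SecondCountableTopology M] [ChartedSpace (EuclideanSpace ℝ (Fin n)) M]
    [IsManifold (𝓡 n) ∞ M] [MeasurableSpace M] [BorelSpace M] :
    ∃ ρ : Measure M, SFinite ρ ∧ lebesgueMeasure n M ≪ ρ ∧ ρ ≪ lebesgueMeasure n M := by
  -- `lebesgueMeasure` is a sum over all points of `M`. Countably many chart domains cover `M`, and
  -- the sum of their patch measures is s-finite, as Fubini requires.
  obtain ⟨T, hT, hTU⟩ := TopologicalSpace.isOpen_iUnion_countable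
    (fun c : M => (chartAt (EuclideanSpace ℝ (Fin n)) c).source) fun c =>
      (chartAt (EuclideanSpace ℝ (Fin n)) c).open_source
  have := hT.to_subtype
  have hsf : ∀ c : M, SFinite (patchMeasure n c) := fun c => by
    unfold patchMeasure
    infer_instance
  have hpatch : ∀ (c : M) {A : Set M}, MeasurableSet A → patchMeasure n c A =
      volume ((chartAt (EuclideanSpace ℝ (Fin n)) c).target ∩
        (chartAt (EuclideanSpace ℝ (Fin n)) c).symm ⁻¹' A) := fun c A hA => by
    have hm : AEMeasurable (chartAt (EuclideanSpace ℝ (Fin n)) c).symm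
        (volume.restrict (chartAt (EuclideanSpace ℝ (Fin n)) c).target) :=
      (chartAt (EuclideanSpace ℝ (Fin n)) c).continuousOn_symm.aemeasurable
        (chartAt (EuclideanSpace ℝ (Fin n)) c).open_target.measurableSet
    rw [patchMeasure, Measure.map_apply_of_aemeasurable hm hA, Measure.restrict_apply'
      (chartAt (EuclideanSpace ℝ (Fin n)) c).open_target.measurableSet, inter_comm]
  refine ⟨Measure.sum fun c : T => patchMeasure n (c : M), inferInstance, ?_, ?_⟩
  · refine Measure.AbsolutelyContinuous.mk fun A hA h => ?_
    rw [Measure.sum_apply_eq_zero] at h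
    have hcov : A ⊆ ⋃ c ∈ T, ((chartAt (EuclideanSpace ℝ (Fin n)) c).source ∩ A) := by
      intro x hx
      have : x ∈ ⋃ c ∈ T, (chartAt (EuclideanSpace ℝ (Fin n)) c).source := by
        rw [hTU]
        exact mem_iUnion.2 ⟨x, mem_chart_source _ x⟩
      obtain ⟨c, hc, hxc⟩ := mem_iUnion₂.1 this
      exact mem_iUnion₂.2 ⟨c, hc, hxc, hx⟩
    refine measure_mono_null hcov ((measure_biUnion_null_iff hT).2 fun c hc => ?_)
    have h0 := h ⟨c, hc⟩
    rw [hpatch c hA] at h0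
    refine measure_mono_null ?_ (lebesgueMeasure_source_inter_preimage_null c h0)
    rintro x ⟨hx, hxA⟩
    refine ⟨hx, (chartAt (EuclideanSpace ℝ (Fin n)) c).map_source hx, ?_⟩
    rwa [mem_preimage, (chartAt (EuclideanSpace ℝ (Fin n)) c).left_inv hx]
  · refine Measure.AbsolutelyContinuous.mk fun A hA h => ?_
    rw [Measure.sum_apply_eq_zero]
    intro c
    rw [hpatch c hA]
    exact volume_target_inter_preimage_symm_null _ h

theorem prod_count_eq_zero_iff {M : Type*} [MeasurableSpace M] (κ : Measure M)
    {A : Set (M × Fin k)} (hA : MeasurableSet A) :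
    κ.prod Measure.count A = 0 ↔ ∀ i, κ {x | (x, i) ∈ A} = 0 := by
  rw [Measure.measure_prod_null hA]
  have h1 : ∀ x, (Measure.count (Prod.mk x ⁻¹' A) = 0) ↔ ∀ i, (x, i) ∉ A := fun x => by
    rw [Measure.count_eq_zero_iff, eq_empty_iff_forall_notMem]
    rfl
  change (∀ᵐ x ∂κ, Measure.count (Prod.mk x ⁻¹' A) = 0) ↔ _
  simp only [h1, ae_all_iff]
  refine forall_congr' fun i => ?_
  rw [ae_iff]
  simp

/-- The Lebesgue decomposition with respect to Lebesgue measure on `M × S`. -/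
theorem exists_singular_carrier (μ : Measure (M × Fin k)) [IsFiniteMeasure μ] :
    ∃ N : Set (M × Fin k), MeasurableSet N ∧ (∀ i, lebesgueMeasure n M {x | (x, i) ∈ N} = 0) ∧
      ∀ A : Set (M × Fin k), MeasurableSet A →
        (∀ i, lebesgueMeasure n M {x | (x, i) ∈ A} = 0) → μ (A \ N) = 0 := by
  obtain ⟨ρ, hρ, h1, h2⟩ := exists_sFinite_equivalent n M
  set ν := (ρ.prod (Measure.count : Measure (Fin k))).toFinite
  have hν : ∀ A : Set (M × Fin k), MeasurableSet A →
      (ν A = 0 ↔ ∀ i, lebesgueMeasure n M {x | (x, i) ∈ A} = 0) := fun A hA => by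
    have h3 : ν A = 0 ↔ ρ.prod Measure.count A = 0 :=
      ⟨fun h => absolutelyContinuous_toFinite _ h, fun h => toFinite_absolutelyContinuous _ h⟩
    rw [h3, prod_count_eq_zero_iff ρ hA]
    exact forall_congr' fun i => ⟨fun h => h1 h, fun h => h2 h⟩
  have hs := Measure.mutuallySingular_singularPart μ ν
  -- This complement is Lebesgue null and carries the singular part; off it only the absolutely
  -- continuous part is left.
  refine ⟨hs.nullSetᶜ, hs.measurableSet_nullSet.compl,
    (hν _ hs.measurableSet_nullSet.compl).1 hs.measure_compl_nullSet, fun A hA h => ?_⟩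
  have hA0 := (hν A hA).2 h
  have h4 := congrArg (fun m : Measure (M × Fin k) => m (A \ hs.nullSetᶜ))
    (Measure.haveLebesgueDecomposition_add μ ν)
  refine h4.trans ?_
  simp only [Measure.add_apply]
  rw [add_eq_zero]
  constructor
  · refine measure_mono_null (fun x hx => ?_) hs.measure_nullSet
    simpa using hx.2
  · exact measure_mono_null sdiff_subset (withDensity_absolutelyContinuous _ _ hA0)

variable {u : Fin k → Π x : M, TangentSpace (𝓡 n) x}
  (hu : ∀ i, IsSmoothField (u i)) (hc : ∀ i, IsForwardComplete (u i)) (law : SwitchingLaw k)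
include hu hc

theorem measurable_chain_processAt {N : Set (M × Fin k)} (hN : MeasurableSet N) (i : Fin k) :
    Measurable fun q : M × ℝ => law.chain i {w | processAt u w q.1 q.2 ∈ N} := by
  have hg : Measurable fun p : (M × ℝ) × (ℕ → Fin k × ℝ) => (p.2, p.1.1, p.1.2) := by fun_prop
  have h := (measurable_processAt hu hc).comp hg
  have h1 := measurable_measure_prodMk_left (ν := law.chain i) (h hN)
  exact h1

theorem measurable_transition (t : ℝ) {N : Set (M × Fin k)} (hN : MeasurableSet N) :
    Measurable fun z => transition u law t z N := by
  refine measurable_from_prod_countable_left fun i => ?_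
  have hg : Measurable fun x : M => (x, t) := by fun_prop
  have h := (measurable_chain_processAt hu hc law hN i).comp hg
  have h1 : ∀ x : M, transition u law t (x, i) N = law.chain i {w | processAt u w x t ∈ N} :=
    fun x => transition_apply hu hc law t (x, i) hN
  simp only [h1]
  exact h

theorem transition_le_one (t : ℝ) (z : M × Fin k) {N : Set (M × Fin k)} (hN : MeasurableSet N) :
    transition u law t z N ≤ 1 := by
  rw [transition_apply hu hc law t z hN]
  exact prob_le_one

/-- The process started at Lebesgue almost every point does not hit a given null set at time `t`. -/
theorem lebesgueMeasure_transition_ne_zero (t : ℝ) {N : Set (M × Fin k)} (hN : MeasurableSet N)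
    (hN0 : ∀ i, lebesgueMeasure n M {x | (x, i) ∈ N} = 0) (i : Fin k) :
    lebesgueMeasure n M {x | transition u law t (x, i) N ≠ 0} = 0 := by
  obtain ⟨ρ, hρ, h1, h2⟩ := exists_sFinite_equivalent n M
  have hm : MeasurableSet {p : (ℕ → Fin k × ℝ) × M | processAt u p.1 p.2 t ∈ N} :=
    ((measurable_processAt hu hc).comp (by fun_prop : Measurable
      fun p : (ℕ → Fin k × ℝ) × M => (p.1, p.2, t))) hN
  have h3 : ((law.chain i).prod ρ) {p | processAt u p.1 p.2 t ∈ N} = 0 :=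
    (Measure.measure_prod_null hm).2 (ae_of_all _ fun w =>
      h2 (lebesgueMeasure_processAt_preimage hu hc w t hN0))
  have h4 : (ρ.prod (law.chain i)) (Prod.swap ⁻¹' {p | processAt u p.1 p.2 t ∈ N}) = 0 := by
    rwa [← Measure.map_apply measurable_swap hm, Measure.prod_swap]
  have h5 := (Measure.measure_prod_null (measurable_swap hm)).1 h4
  refine h1 (ae_iff.1 (h5.mono fun x hx => ?_))
  rw [transition_apply hu hc law t _ hN]
  exact hx

/-- An ergodic invariant measure that is not absolutely continuous is carried by a null set, which
the process does not leave. -/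
theorem exists_null_carrier {μ : Measure (M × Fin k)} (hμ : IsErgodic u law μ)
    (hac : ¬ μ ≪ (lebesgueMeasure n M).prod Measure.count) :
    ∃ N : Set (M × Fin k), MeasurableSet N ∧ (∀ i, lebesgueMeasure n M {x | (x, i) ∈ N} = 0) ∧
      ∀ t, 0 ≤ t → ∀ᵐ z ∂μ, transition u law t z N = 1 := by
  have := hμ.isProbabilityMeasure
  obtain ⟨N, hN, hN0, hNac⟩ := exists_singular_carrier (n := n) μ
  have hinv : ∀ t, 0 ≤ t → ∫⁻ z in N, transition u law t z N ∂μ = μ N := by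
    intro t ht
    have h1 := hμ.invariant t ht N hN
    rw [← lintegral_add_compl _ hN] at h1
    -- The starts from which `N` is reached with positive probability form a Lebesgue null set, and
    -- off `N` null sets have `μ`-measure zero.
    have h2 : ∫⁻ z in Nᶜ, transition u law t z N ∂μ = 0 := by
      rw [lintegral_eq_zero_iff (measurable_transition hu hc law t hN), Filter.EventuallyEq,
        ae_restrict_iff' hN.compl, ae_iff]
      have hB : MeasurableSet {z | transition u law t z N ≠ 0} :=
        (measurable_transition hu hc law t hN) (measurableSet_singleton 0).compl
      have h3 := hNac _ hB (lebesgueMeasure_transition_ne_zero hu hc law t hN hN0)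
      refine measure_mono_null (fun z hz => ?_) h3
      simp only [mem_ofPred_eq, Classical.not_imp] at hz
      exact ⟨hz.2, hz.1⟩
    rwa [h2, add_zero] at h1
  have hone : ∀ t, 0 ≤ t → ∀ᵐ z ∂μ, z ∈ N → transition u law t z N = 1 := by
    intro t ht
    have h1 := hinv t ht
    rw [← ae_restrict_iff' hN]
    have h2 : ∫⁻ z in N, transition u law t z N ∂μ = ∫⁻ _ in N, 1 ∂μ := by simpa using h1
    -- A function bounded by `1` whose integral over `N` is `μ N` equals `1` almost everywhere on
    -- `N`.
    have h3 := ae_eq_of_ae_le_of_lintegral_le (μ := μ.restrict N)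
      (ae_of_all _ fun z => transition_le_one hu hc law t z hN)
      (by rw [h1]; exact measure_ne_top _ _) aemeasurable_const h2.ge
    exact h3
  rcases hμ.zero_or_one N ⟨hN, hone⟩ with h | h
  · refine ⟨N, hN, hN0, fun t ht => ?_⟩
    have h1 : ∀ᵐ z ∂μ, z ∈ N := by
      rw [← prob_compl_eq_zero_iff hN] at h
      exact h
    filter_upwards [hone t ht, h1] with z hz hzN using hz hzN
  · refine absurd (Measure.AbsolutelyContinuous.mk fun A hA hA0 => ?_) hac
    rw [prod_count_eq_zero_iff _ hA] at hA0
    have h1 := hNac A hA hA0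
    have h2 : μ A ≤ μ (A \ N) + μ N := by
      refine (measure_mono ?_).trans (measure_union_le _ _)
      rw [sdiff_union_self]
      exact subset_union_left
    rw [h1, h, add_zero] at h2
    exact le_antisymm h2 zero_le

end Singular

/-! ### Renewal at the first switch -/

section Renewal

theorem ae_restrict_Ioi_add {P : ℝ → Prop} {s : ℝ} (hs : 0 ≤ s)
    (h : ∀ᵐ t ∂(volume : Measure ℝ).restrict (Ioi 0), P t) :
    ∀ᵐ t ∂(volume : Measure ℝ).restrict (Ioi 0), P (t + s) := by
  rw [ae_restrict_iff' measurableSet_Ioi] at h ⊢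
  have h1 := (measurePreserving_add_right (volume : Measure ℝ) s).quasiMeasurePreserving.ae h
  filter_upwards [h1] with t ht ht0
  exact ht (add_pos_of_pos_of_nonneg ht0 hs)

theorem exists_gt_of_ae_restrict_Ioi {P : ℝ → Prop} (a : ℝ)
    (h : ∀ᵐ t ∂(volume : Measure ℝ).restrict (Ioi 0), P t) : ∃ t, a < t ∧ P t := by
  by_contra! hcon
  rw [ae_restrict_iff' measurableSet_Ioi, ae_iff] at h
  have h1 : Ioi (max a 0) ⊆ {t : ℝ | ¬(t ∈ Ioi 0 → P t)} := fun t ht h2 =>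
    hcon t ((le_max_left a 0).trans_lt ht) (h2 (mem_Ioi.2 ((le_max_right a 0).trans_lt ht)))
  simpa using measure_mono_null h1 h

variable {k : ℕ}

theorem switchTime_consPath (p : (Fin k × ℝ) × (ℕ → Fin k × ℝ)) (m : ℕ) :
    switchTime (consPath p) (m + 1) = p.1.2 + switchTime p.2 m := by
  rw [switchTime, Finset.sum_range_succ', add_comm]
  rfl

theorem switchCount_consPath_of_lt {i : Fin k} {s t : ℝ} (ht : 0 ≤ t) (hts : t < s)
    {w : ℕ → Fin k × ℝ} (hw : ∀ l, 0 ≤ (w l).2) :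
    {m | switchTime (consPath ((i, s), w)) m ≤ t} = {0} := by
  ext m
  cases m with
  | zero => simpa [switchTime] using ht
  | succ m =>
    have : 0 ≤ switchTime w m := Finset.sum_nonneg fun l _ => hw l
    simp only [mem_ofPred_eq, switchTime_consPath, mem_singleton_iff, Nat.succ_ne_zero, iff_false]
    linarith

theorem switchTime_consPath_le (i : Fin k) {s t : ℝ} (hst : 0 ≤ t + s) (w : ℕ → Fin k × ℝ) :
    {m | switchTime (consPath ((i, s), w)) m ≤ t + s} =
      insert 0 (Nat.succ '' {m | switchTime w m ≤ t}) := by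
  ext m
  cases m with
  | zero => simpa [switchTime] using hst
  | succ m => simp [switchTime_consPath, add_comm s]

/-- Boundedness is essential: if the switches accumulate, both counts are the default `0` and the
formula is off by one. -/
theorem switchCount_consPath (i : Fin k) {s t : ℝ} (hs : 0 ≤ s) (ht : 0 ≤ t)
    {w : ℕ → Fin k × ℝ} (hb : BddAbove {m | switchTime w m ≤ t}) :
    switchCount (consPath ((i, s), w)) (t + s) = switchCount w t + 1 := by
  have h0 : (0 : ℕ) ∈ {m | switchTime w m ≤ t} := by simpa [switchTime] using ht
  have h1 := Nat.sSup_mem ⟨0, h0⟩ hb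
  rw [switchCount, switchTime_consPath_le i (add_nonneg ht hs)]
  refine IsGreatest.csSup_eq ⟨Or.inr ⟨_, h1, rfl⟩, ?_⟩
  rintro m (rfl | ⟨m, hm, rfl⟩)
  · exact Nat.zero_le _
  · exact Nat.succ_le_succ (le_csSup hb hm)

variable {n : ℕ} {M : Type*} [TopologicalSpace M]
  [ChartedSpace (EuclideanSpace ℝ (Fin n)) M] (u : Fin k → Π x : M, TangentSpace (𝓡 n) x)

theorem switchPosition_consPath (i : Fin k) (s : ℝ) (w : ℕ → Fin k × ℝ) (x : M) (m : ℕ) :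
    switchPosition u (consPath ((i, s), w)) x (m + 1) =
      switchPosition u w (flow (u i) s x) m := by
  induction m with
  | zero => rfl
  | succ m ih =>
    rw [switchPosition, ih]
    rfl

theorem processAt_consPath (i : Fin k) {s t : ℝ} (hs : 0 ≤ s) (ht : 0 ≤ t)
    {w : ℕ → Fin k × ℝ} (hb : BddAbove {m | switchTime w m ≤ t}) (x : M) :
    processAt u (consPath ((i, s), w)) x (t + s) = processAt u w (flow (u i) s x) t := by
  have h : t + s - (s + switchTime w (switchCount w t)) = t - switchTime w (switchCount w t) := by
    ring
  simp only [processAt, switchCount_consPath i hs ht hb, switchPosition_consPath,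
    switchTime_consPath, h]
  rfl

theorem processAt_consPath_of_lt (i : Fin k) {s t : ℝ} (ht : 0 ≤ t) (hts : t < s)
    {w : ℕ → Fin k × ℝ} (hw : ∀ l, 0 ≤ (w l).2) (x : M) :
    processAt u (consPath ((i, s), w)) x t = (flow (u i) t x, i) := by
  have h : switchCount (consPath ((i, s), w)) t = 0 := by
    rw [switchCount, switchCount_consPath_of_lt ht hts hw, csSup_singleton]
  simp only [processAt, h, switchTime, Finset.range_zero, Finset.sum_empty, sub_zero]
  rfl

variable (law : SwitchingLaw k) (N : Set (M × Fin k))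

/-- The process started at `(x, i)` almost surely is in `N` at almost all times before the switching
times accumulate. -/
def StaysIn (i : Fin k) (x : M) : Prop :=
  ∀ᵐ w ∂law.chain i, ∀ᵐ t ∂(volume : Measure ℝ).restrict (Ioi 0),
    BddAbove {m | switchTime w m ≤ t} → processAt u w x t ∈ N

/-- Along the trajectory of `u i` started at `x`, almost all points lie in `N`, and the process
that switches at almost any of them stays in `N`. -/
def StaysInAlong (i : Fin k) (x : M) : Prop :=
  (∀ᵐ s ∂(volume : Measure ℝ).restrict (Ioi 0), (flow (u i) s x, i) ∈ N) ∧
    ∀ j, j ≠ i → ∀ᵐ s ∂(volume : Measure ℝ).restrict (Ioi 0), StaysIn u law N j (flow (u i) s x)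

variable [T2Space M] [SecondCountableTopology M] [IsManifold (𝓡 n) ∞ M] [MeasurableSpace M]
  [BorelSpace M] {u N} (hu : ∀ i, IsSmoothField (u i)) (hc : ∀ i, IsForwardComplete (u i))
include hu hc

theorem measurableSet_ae_flow (i : Fin k) {A : Set M} (hA : MeasurableSet A) :
    MeasurableSet {x | ∀ᵐ s ∂(volume : Measure ℝ).restrict (Ioi 0), flow (u i) s x ∈ A} := by
  have h := measurable_measure_prodMk_right (μ := (volume : Measure ℝ).restrict (Ioi 0))
    ((measurable_flow (hu i) (hc i)) hA).compl
  exact h (measurableSet_singleton 0)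

variable (hN : MeasurableSet N)
include hN

theorem measurableSet_staysBefore :
    MeasurableSet {q : ((ℕ → Fin k × ℝ) × M) × ℝ |
      BddAbove {m | switchTime q.1.1 m ≤ q.2} → processAt u q.1.1 q.1.2 q.2 ∈ N} := by
  have hg : Measurable fun q : ((ℕ → Fin k × ℝ) × M) × ℝ => (q.1.1, q.1.2, q.2) := by fun_prop
  have h1 := ((measurable_processAt hu hc).comp hg) hN
  have h2 : MeasurableSet {q : ((ℕ → Fin k × ℝ) × M) × ℝ |
      BddAbove {m | switchTime q.1.1 m ≤ q.2}} := by
    have : {q : ((ℕ → Fin k × ℝ) × M) × ℝ | BddAbove {m | switchTime q.1.1 m ≤ q.2}} =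
        ⋃ B : ℕ, ⋂ m : ℕ, {q | switchTime q.1.1 m ≤ q.2 → m ≤ B} := by
      ext q
      simp only [mem_iUnion, mem_iInter]
      rfl
    rw [this]
    refine MeasurableSet.iUnion fun B => MeasurableSet.iInter fun m => ?_
    refine MeasurableSet.imp (measurableSet_le ?_ measurable_snd) (MeasurableSet.const _)
    exact (measurable_switchTime m).comp (measurable_fst.comp measurable_fst)
  exact h2.imp h1

theorem measurableSet_ae_staysBefore :
    MeasurableSet {q : (ℕ → Fin k × ℝ) × M | ∀ᵐ t ∂(volume : Measure ℝ).restrict (Ioi 0),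
      BddAbove {m | switchTime q.1 m ≤ t} → processAt u q.1 q.2 t ∈ N} := by
  have h := measurable_measure_prodMk_left (ν := (volume : Measure ℝ).restrict (Ioi 0))
    (measurableSet_staysBefore hu hc hN).compl
  exact h (measurableSet_singleton 0)

theorem measurableSet_staysIn (i : Fin k) : MeasurableSet {x | StaysIn u law N i x} := by
  have h := measurable_measure_prodMk_right (μ := law.chain i)
    (measurableSet_ae_staysBefore hu hc hN).compl
  exact h (measurableSet_singleton 0)

theorem measurableSet_staysInAlong (i : Fin k) :
    MeasurableSet {x | StaysInAlong u law N i x} := by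
  have h1 : MeasurableSet {x | ∀ᵐ s ∂(volume : Measure ℝ).restrict (Ioi 0),
      (flow (u i) s x, i) ∈ N} :=
    measurableSet_ae_flow hu hc i (A := (fun x => (x, i)) ⁻¹' N) (measurable_prodMk_right hN)
  have h2 : MeasurableSet (⋂ j, {x | j ≠ i →
      ∀ᵐ s ∂(volume : Measure ℝ).restrict (Ioi 0), StaysIn u law N j (flow (u i) s x)}) := by
    refine MeasurableSet.iInter fun j => (MeasurableSet.const _).imp ?_
    exact measurableSet_ae_flow hu hc i (measurableSet_staysIn law hu hc hN j)
  convert h1.inter h2 using 1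
  ext x
  simp [StaysInAlong]

/-- Disintegration at the first switch. Before it the process is on the trajectory of `u i`; after a
switch at time `s` to state `j` it restarts at the point reached. -/
theorem StaysIn.staysInAlong {i : Fin k} (hi : ∃ j, j ≠ i) {x : M} (h : StaysIn u law N i x) :
    StaysInAlong u law N i x := by
  have hm : MeasurableSet {w : ℕ → Fin k × ℝ | ∀ᵐ t ∂(volume : Measure ℝ).restrict (Ioi 0),
      BddAbove {m | switchTime w m ≤ t} → processAt u w x t ∈ N} :=
    measurable_prodMk_right (measurableSet_ae_staysBefore hu hc hN)
  constructor
  · obtain ⟨j, hj⟩ := hi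
    have h1 := ae_ae_consPath law i j hj hm h
    -- A waiting time `s` controls the trajectory only up to `s`; countably many arbitrarily long
    -- ones cover all positive times.
    have h2 : ∀ a : ℕ, ∃ s : ℝ, a < s ∧
        ∀ᵐ t ∂(volume : Measure ℝ).restrict (Ioi 0), t < s → (flow (u i) t x, i) ∈ N := by
      intro a
      obtain ⟨s, has, hs⟩ := exists_gt_of_ae_restrict_Ioi a h1
      obtain ⟨w, hw1, hw2⟩ := (hs.and (ae_chain_nonneg law j)).exists
      refine ⟨s, has, ?_⟩
      filter_upwards [hw1, ae_restrict_mem measurableSet_Ioi] with t ht ht0 hts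
      rw [← processAt_consPath_of_lt u i (le_of_lt ht0) hts hw2]
      refine ht ?_
      rw [switchCount_consPath_of_lt (le_of_lt ht0) hts hw2]
      exact bddAbove_singleton
    choose s hs1 hs2 using h2
    filter_upwards [ae_all_iff.2 hs2] with t ht
    obtain ⟨a, ha⟩ := exists_nat_gt t
    exact ht a (ha.trans (hs1 a))
  · intro j hj
    filter_upwards [ae_ae_consPath law i j hj hm h, ae_restrict_mem measurableSet_Ioi] with s hs hs0
    refine hs.mono fun w hw => ?_
    filter_upwards [ae_restrict_Ioi_add (le_of_lt hs0) hw, ae_restrict_mem measurableSet_Ioi]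
      with t ht ht0 hb
    rw [← processAt_consPath u i (le_of_lt hs0) (le_of_lt ht0) hb]
    refine ht ?_
    rw [switchTime_consPath_le i (add_nonneg (le_of_lt ht0) (le_of_lt hs0))]
    exact (Monotone.map_bddAbove Order.succ_mono hb).insert 0

/-- For `l = i` the property is moved along the trajectory by the semigroup law alone, without
memorylessness of the waiting times; for `l ≠ i` it is the restart after a switch to `l`. The
hypothesis concerns one state and the conclusion all states, so the conclusion is hereditary. -/
theorem StaysInAlong.ae_forall {i : Fin k} {x : M} (h : StaysInAlong u law N i x) :
    ∀ᵐ s ∂(volume : Measure ℝ).restrict (Ioi 0),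
      ∀ l, StaysInAlong u law N l (flow (u i) s x) := by
  rw [ae_all_iff]
  intro l
  rcases eq_or_ne l i with rfl | hl
  · filter_upwards [ae_restrict_mem measurableSet_Ioi] with s hs
    have hs0 : (0 : ℝ) ≤ s := le_of_lt hs
    constructor
    · filter_upwards [ae_restrict_Ioi_add hs0 h.1, ae_restrict_mem measurableSet_Ioi] with t ht ht0
      rwa [flow_add (hu l) (hc l) (le_of_lt ht0) hs0] at ht
    · intro j hj
      filter_upwards [ae_restrict_Ioi_add hs0 (h.2 j hj), ae_restrict_mem measurableSet_Ioi]
        with t ht ht0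
      rwa [flow_add (hu l) (hc l) (le_of_lt ht0) hs0] at ht
  · filter_upwards [h.2 l hl] with s hs
    exact hs.staysInAlong law hu hc hN ⟨i, hl.symm⟩

/-- If the process is almost surely in `N` at every fixed time, it is in `N` at almost all times. -/
theorem ae_staysIn {μ : Measure (M × Fin k)} [IsFiniteMeasure μ]
    (h : ∀ t, 0 ≤ t → ∀ᵐ z ∂μ, transition u law t z N = 1) :
    ∀ᵐ z ∂μ, StaysIn u law N z.2 z.1 := by
  have hm : MeasurableSet {q : (M × Fin k) × ℝ | transition u law q.2 q.1 N = 1} := by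
    have h1 : Measurable fun q : (M × ℝ) × Fin k => transition u law q.1.2 (q.1.1, q.2) N := by
      refine measurable_from_prod_countable_left fun i => ?_
      have h2 : ∀ q : M × ℝ, transition u law q.2 (q.1, i) N =
          law.chain i {w | processAt u w q.1 q.2 ∈ N} :=
        fun q => transition_apply hu hc law q.2 (q.1, i) hN
      simp only [h2]
      exact measurable_chain_processAt hu hc law hN i
    have h3 : Measurable fun q : (M × Fin k) × ℝ => ((q.1.1, q.2), q.1.2) := by fun_prop
    exact (h1.comp h3) (measurableSet_singleton 1)
  have h1 : ∀ᵐ t ∂(volume : Measure ℝ).restrict (Ioi 0), ∀ᵐ z ∂μ, transition u law t z N = 1 := by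
    filter_upwards [ae_restrict_mem measurableSet_Ioi] with t ht using h t (le_of_lt ht)
  filter_upwards [(Measure.ae_ae_comm hm).2 h1] with z hz
  have hg : Measurable fun q : (ℕ → Fin k × ℝ) × ℝ => (q.1, z.1, q.2) := by fun_prop
  have hm2 : MeasurableSet {q : (ℕ → Fin k × ℝ) × ℝ | processAt u q.1 z.1 q.2 ∈ N} :=
    (Measurable.comp (g := fun q : (ℕ → Fin k × ℝ) × M × ℝ => processAt u q.1 q.2.1 q.2.2)
      (measurable_processAt hu hc) hg) hN
  have h2 : ∀ᵐ t ∂(volume : Measure ℝ).restrict (Ioi 0), ∀ᵐ w ∂law.chain z.2,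
      processAt u w z.1 t ∈ N := by
    filter_upwards [hz] with t ht
    have hm3 := (measurable_prodMk_right (y := t)) hm2
    rw [transition_apply hu hc law t z hN] at ht
    exact (prob_compl_eq_zero_iff hm3).2 ht
  filter_upwards [(Measure.ae_ae_comm hm2).2 h2] with w hw
  -- The non-accumulation premise is dropped: membership in `N` holds even where the process takes
  -- its default value.
  filter_upwards [hw] with t ht _ using ht

end Renewal

/-! ### Reachable sets with interior -/

section Reachable

variable {n : ℕ} {M : Type*} [TopologicalSpace M]
  [ChartedSpace (EuclideanSpace ℝ (Fin n)) M] [IsManifold (𝓡 n) ∞ M]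

/-- The value of a vector field at a point of a chart, as a linear map. -/
noncomputable def localFieldAt (c : M) (y : EuclideanSpace ℝ (Fin n)) :
    (Π x : M, TangentSpace (𝓡 n) x) →ₗ[ℝ] EuclideanSpace ℝ (Fin n) where
  toFun V := localField c V y
  map_add' V W := congrFun (localField_add c V W) y
  map_smul' a V := congrFun (localField_smul c a V) y

variable {ι : Type*} {u : ι → Π x : M, TangentSpace (𝓡 n) x}

theorem isSmoothField_of_mem_generatedAlgebra (hu : ∀ i, IsSmoothField (u i))
    {V : Π x : M, TangentSpace (𝓡 n) x} (hV : V ∈ generatedAlgebra u) : IsSmoothField V := by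
  obtain ⟨A, hA, hAu⟩ := exists_isSubalgebra u hu
  exact hA.smooth V (Submodule.mem_sInf.1 hV A ⟨hA, hAu⟩)

theorem map_localFieldAt_eq_top {c : M} {y : EuclideanSpace ℝ (Fin n)}
    (hy : y ∈ (chartAt (EuclideanSpace ℝ (Fin n)) c).target)
    (hB : ConditionB u ((chartAt (EuclideanSpace ℝ (Fin n)) c).symm y)) :
    (generatedAlgebra u).map (localFieldAt c y) = ⊤ := by
  set e := chartAt (EuclideanSpace ℝ (Fin n)) c
  have hfin : FiniteDimensional ℝ (TangentSpace (𝓡 n) (e.symm y)) :=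
    inferInstanceAs (FiniteDimensional ℝ (EuclideanSpace ℝ (Fin n)))
  have hdim : Module.finrank ℝ (TangentSpace (𝓡 n) (e.symm y)) = n :=
    finrank_euclideanSpace_fin (𝕜 := ℝ) (n := n)
  have htop := Submodule.eq_top_of_finrank_eq (hB.trans hdim.symm)
  refine eq_top_iff.2 fun w _ => ?_
  have hw : mfderiv (𝓡 n) (𝓡 n) e.symm y w ∈ (generatedAlgebra u).map
      (LinearMap.proj (e.symm y) :
        (Π x : M, TangentSpace (𝓡 n) x) →ₗ[ℝ] TangentSpace (𝓡 n) (e.symm y)) := by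
    rw [htop]
    exact Submodule.mem_top
  obtain ⟨V, hV, hVw⟩ := hw
  refine ⟨V, hV, ?_⟩
  have h1 := mfderiv_chartAt_symm_localField (V := V) hy
  exact (isInvertible_mfderiv_chartAt_symm (c := c) hy).injective (h1.trans hVw)

/-- The condition that the generated algebra spans is open. -/
theorem eventually_map_localFieldAt_eq_top (hu : ∀ i, IsSmoothField (u i)) {c : M}
    {y : EuclideanSpace ℝ (Fin n)} (hy : y ∈ (chartAt (EuclideanSpace ℝ (Fin n)) c).target)
    (h : (generatedAlgebra u).map (localFieldAt c y) = ⊤) :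
    ∀ᶠ z in 𝓝 y, (generatedAlgebra u).map (localFieldAt c z) = ⊤ := by
  have hV : ∀ i : Fin n, ∃ V ∈ generatedAlgebra u,
      localField c V y = EuclideanSpace.single i (1 : ℝ) := fun i => by
    have : EuclideanSpace.single i (1 : ℝ) ∈ (generatedAlgebra u).map (localFieldAt c y) := by
      rw [h]
      exact Submodule.mem_top
    exact this
  choose V hV hVy using hV
  -- `A z` sends the standard basis to the values at `z` of fields that equal this basis at `y`. It
  -- is the identity at `y`, hence bijective nearby.
  let A : EuclideanSpace ℝ (Fin n) → EuclideanSpace ℝ (Fin n) →L[ℝ] EuclideanSpace ℝ (Fin n) :=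
    fun z => ∑ i, (EuclideanSpace.proj i : EuclideanSpace ℝ (Fin n) →L[ℝ] ℝ).smulRight
      (localField c (V i) z)
  have hA : ∀ z w, A z w = ∑ i, w i • localField c (V i) z := fun z w => by
    simp [A]
  have hcont : ContinuousAt A y := by
    refine tendsto_finsetSum _ fun i _ => ?_
    have h1 := (contDiffAt_localField (isSmoothField_of_mem_generatedAlgebra hu (hV i))
      hy).continuousAt
    exact ((ContinuousLinearMap.smulRightL ℝ (EuclideanSpace ℝ (Fin n))
      (EuclideanSpace ℝ (Fin n)) (EuclideanSpace.proj i)).continuous.continuousAt.comp h1)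
  have hAy : Function.Injective (A y) := by
    have : ∀ w, A y w = w := fun w => by
      rw [hA]
      simp only [hVy]
      ext j
      simp [Finset.sum_apply, Pi.single_apply]
    intro v w hvw
    rwa [this, this] at hvw
  filter_upwards [hcont.eventually (eventually_injective hAy)] with z hz
  have hsurj : Function.Surjective
      (A z : EuclideanSpace ℝ (Fin n) →ₗ[ℝ] EuclideanSpace ℝ (Fin n)) :=
    LinearMap.injective_iff_surjective.1 hz
  refine eq_top_iff.2 fun w _ => ?_
  obtain ⟨a, rfl⟩ := hsurj w
  change A z a ∈ _
  rw [hA]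
  exact Submodule.sum_mem _ fun i _ => Submodule.smul_mem _ _ ⟨V i, hV i, rfl⟩

variable {P : Type*} [NormedAddCommGroup P] [NormedSpace ℝ P] [FiniteDimensional ℝ P]

/-- If the generating fields are tangent to an immersed manifold, so is the generated algebra. -/
theorem localField_mem_range_of_mem_generatedAlgebra (hu : ∀ i, IsSmoothField (u i)) {c : M}
    {f : P → EuclideanSpace ℝ (Fin n)} {O : Set P} (hO : IsOpen O)
    (hf : ∀ θ ∈ O, ContDiffAt ℝ 2 f θ) (hinj : ∀ θ ∈ O, Function.Injective (fderiv ℝ f θ))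
    (hfO : ∀ θ ∈ O, f θ ∈ (chartAt (EuclideanSpace ℝ (Fin n)) c).target)
    (ht : ∀ θ ∈ O, ∀ i, localField c (u i) (f θ) ∈ (fderiv ℝ f θ).range)
    {V : Π x : M, TangentSpace (𝓡 n) x} (hV : V ∈ generatedAlgebra u) {θ : P} (hθ : θ ∈ O) :
    localField c V (f θ) ∈ (fderiv ℝ f θ).range := by
  obtain ⟨A, hA, hAu⟩ := exists_isSubalgebra u hu
  let T : Submodule ℝ (Π x : M, TangentSpace (𝓡 n) x) :=
    ⨅ θ ∈ O, ((fderiv ℝ f θ).range).comap (localFieldAt c (f θ))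
  have hT : ∀ V, V ∈ T ↔ ∀ θ ∈ O, localField c V (f θ) ∈ (fderiv ℝ f θ).range := fun V => by
    simp only [T, Submodule.mem_iInf]
    rfl
  -- Tangency is closed under brackets of smooth fields. Intersecting with the smooth subalgebra `A`
  -- gives a competitor in the infimum that defines `generatedAlgebra`.
  have hAT : IsSubalgebra (A ⊓ T) := by
    refine ⟨fun V hV => hA.smooth V hV.1, fun V hV W hW => ⟨hA.bracket V hV.1 W hW.1, ?_⟩⟩
    refine (hT _).2 fun θ hθ => ?_
    have hVs := hA.smooth V hV.1
    have hWs := hA.smooth W hW.1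
    rw [localField_mlieBracket hVs hWs (hfO θ hθ)]
    refine lieBracket_mem_range (hf θ hθ) (hinj θ hθ)
      ((contDiffAt_localField hVs (hfO θ hθ)).differentiableAt (by simp))
      ((contDiffAt_localField hWs (hfO θ hθ)).differentiableAt (by simp)) ?_ ?_
    · filter_upwards [hO.mem_nhds hθ] with θ' hθ' using (hT V).1 hV.2 θ' hθ'
    · filter_upwards [hO.mem_nhds hθ] with θ' hθ' using (hT W).1 hW.2 θ' hθ'
  have hmem := Submodule.mem_sInf.1 hV (A ⊓ T)
    ⟨hAT, fun i => ⟨hAu i, (hT _).2 fun θ hθ => ht θ hθ i⟩⟩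
  exact (hT V).1 hmem.2 θ hθ

theorem exists_localField_notMem_range (hu : ∀ i, IsSmoothField (u i)) {c : M}
    {f : P → EuclideanSpace ℝ (Fin n)} {O : Set P} (hO : IsOpen O) (hne : O.Nonempty)
    (hf : ∀ θ ∈ O, ContDiffAt ℝ 2 f θ) (hinj : ∀ θ ∈ O, Function.Injective (fderiv ℝ f θ))
    (hfO : ∀ θ ∈ O, f θ ∈ (chartAt (EuclideanSpace ℝ (Fin n)) c).target)
    (hspan : ∀ θ ∈ O, (generatedAlgebra u).map (localFieldAt c (f θ)) = ⊤)
    (hdim : Module.finrank ℝ P < n) :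
    ∃ θ ∈ O, ∃ i, localField c (u i) (f θ) ∉ (fderiv ℝ f θ).range := by
  by_contra! ht
  obtain ⟨θ, hθ⟩ := hne
  have h1 : (⊤ : Submodule ℝ (EuclideanSpace ℝ (Fin n))) ≤ (fderiv ℝ f θ).range := by
    rw [← hspan θ hθ]
    rintro _ ⟨V, hV, rfl⟩
    exact localField_mem_range_of_mem_generatedAlgebra hu hO hf hinj hfO ht hV hθ
  have h2 := LinearMap.finrank_range_le (fderiv ℝ f θ : P →ₗ[ℝ] EuclideanSpace ℝ (Fin n))
  have h3 := Submodule.finrank_mono h1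
  rw [finrank_top, finrank_euclideanSpace_fin] at h3
  exact absurd (h3.trans h2) (not_le.2 hdim)

end Reachable

/-! ### Raising the dimension of immersed manifolds by flowing -/

section Krener

variable {n : ℕ} {M : Type*} [TopologicalSpace M] [T2Space M]
  [ChartedSpace (EuclideanSpace ℝ (Fin n)) M] [IsManifold (𝓡 n) ∞ M]
  [MeasurableSpace M] [BorelSpace M]
  {ι : Type*} {u : ι → Π x : M, TangentSpace (𝓡 n) x}

/-- Flowing along a field that is transversal to an immersed manifold raises the dimension. -/
theorem exists_immersion_prod (hu : ∀ i, IsSmoothField (u i)) (hc : ∀ i, IsForwardComplete (u i))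
    {c : M} {Ω : Set (EuclideanSpace ℝ (Fin n))} (hΩo : IsOpen Ω)
    (hΩ : Ω ⊆ (chartAt (EuclideanSpace ℝ (Fin n)) c).target) {H : M → Prop}
    (hHm : MeasurableSet {x | H x})
    (hH : ∀ x, H x → ∀ i, ∀ᵐ s ∂(volume : Measure ℝ).restrict (Ioi 0), H (flow (u i) s x))
    {P : Type*} [NormedAddCommGroup P] [NormedSpace ℝ P] [FiniteDimensional ℝ P]
    [MeasurableSpace P] [BorelSpace P] (ν : Measure P) [ν.IsAddHaarMeasure]
    {f : P → EuclideanSpace ℝ (Fin n)} {O : Set P} (hO : IsOpen O) {θ₀ : P} (hθ₀ : θ₀ ∈ O)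
    (hf : ∀ θ ∈ O, ContDiffAt ℝ 2 f θ) (hinj : ∀ θ ∈ O, Function.Injective (fderiv ℝ f θ))
    (hfO : ∀ θ ∈ O, f θ ∈ Ω)
    (hae : ∀ᵐ θ ∂ν, θ ∈ O → H ((chartAt (EuclideanSpace ℝ (Fin n)) c).symm (f θ))) {l : ι}
    (hl : localField c (u l) (f θ₀) ∉ (fderiv ℝ f θ₀).range) :
    ∃ (g : P × ℝ → EuclideanSpace ℝ (Fin n)) (U : Set (P × ℝ)), IsOpen U ∧ U.Nonempty ∧
      (∀ q ∈ U, ContDiffAt ℝ 2 g q) ∧ (∀ q ∈ U, Function.Injective (fderiv ℝ g q)) ∧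
      (∀ q ∈ U, g q ∈ Ω) ∧ ∀ᵐ q ∂ν.prod volume, q ∈ U →
        H ((chartAt (EuclideanSpace ℝ (Fin n)) c).symm (g q)) := by
  set e := chartAt (EuclideanSpace ℝ (Fin n)) c
  obtain ⟨φ, hφ, hφ0, hφv, ε, hε, hflow⟩ := exists_local_flow (hu l) (hc l) c (hΩ (hfO θ₀ hθ₀))
  obtain ⟨hg, hgi⟩ := injective_fderiv_flow_comp (hf θ₀ hθ₀) (hinj θ₀ hθ₀) hφ hφ0 hl hφv
  set g : P × ℝ → EuclideanSpace ℝ (Fin n) := fun q => φ (q.2, f q.1) with hgdef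
  have e1 : ∀ᶠ q in 𝓝 (θ₀, (0 : ℝ)), ContDiffAt ℝ 2 g q := hg.eventually (by simp)
  have e2 : ∀ᶠ q in 𝓝 (θ₀, (0 : ℝ)), Function.Injective (fderiv ℝ g q) := by
    have h1 : ContDiffAt ℝ 1 (fderiv ℝ g) (θ₀, (0 : ℝ)) := hg.fderiv_right (by norm_num)
    exact h1.continuousAt.eventually (eventually_injective hgi)
  have e3 : ∀ᶠ q in 𝓝 (θ₀, (0 : ℝ)), g q ∈ Ω := by
    refine hg.continuousAt.eventually_mem (hΩo.mem_nhds ?_)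
    simp only [hgdef]
    rw [hφ0.self_of_nhds]
    exact hfO θ₀ hθ₀
  have hfst : Tendsto (Prod.fst : P × ℝ → P) (𝓝 (θ₀, (0 : ℝ))) (𝓝 θ₀) := continuousAt_fst
  have hsnd : Tendsto (Prod.snd : P × ℝ → ℝ) (𝓝 (θ₀, (0 : ℝ))) (𝓝 0) := continuousAt_snd
  have e4 : ∀ᶠ q in 𝓝 (θ₀, (0 : ℝ)), q.1 ∈ O := hfst.eventually (hO.mem_nhds hθ₀)
  have e5 : ∀ᶠ q in 𝓝 (θ₀, (0 : ℝ)), q.2 < ε := hsnd.eventually (gt_mem_nhds hε)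
  have e6 : ∀ᶠ q in 𝓝 (θ₀, (0 : ℝ)), ∀ t ∈ Icc 0 ε, φ (t, f q.1) ∈ e.target ∧
      flow (u l) t (e.symm (f q.1)) = e.symm (φ (t, f q.1)) :=
    ((hf θ₀ hθ₀).continuousAt.tendsto.comp hfst).eventually hflow
  obtain ⟨U, hU, hUo, hmem⟩ := eventually_nhds_iff.1
    (e1.and (e2.and (e3.and (e4.and (e5.and e6)))))
  have hU'o : IsOpen (U ∩ {q : P × ℝ | 0 < q.2}) :=
    hUo.inter (isOpen_lt continuous_const continuous_snd)
  have hgc : ContinuousOn (fun q => e.symm (g q)) (U ∩ {q : P × ℝ | 0 < q.2}) := fun q hq =>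
    ((e.continuousAt_symm (hΩ (hU q hq.1).2.2.1)).comp
      (hU q hq.1).1.continuousAt).continuousWithinAt
  -- Only positive times are kept, since `g` represents the flow and `hH` gives information only
  -- there. The base point at time `0` lies on the boundary, so the set is nonempty.
  refine ⟨g, U ∩ {q | 0 < q.2}, hU'o, ?_, fun q hq => (hU q hq.1).1, fun q hq => (hU q hq.1).2.1,
    fun q hq => (hU q hq.1).2.2.1, ?_⟩
  · have h1 : Tendsto (fun s : ℝ => (θ₀, s)) (𝓝[>] 0) (𝓝 (θ₀, 0)) :=
      (Continuous.prodMk_right θ₀).continuousAt.tendsto.mono_left nhdsWithin_le_nhds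
    obtain ⟨s, hs, hs0⟩ :=
      ((h1.eventually (hUo.mem_nhds hmem)).and self_mem_nhdsWithin).exists
    exact ⟨(θ₀, s), hs, hs0⟩
  · have hm := measurableSet_inter_preimage_of_continuousOn hgc hU'o hHm.compl
    have hnull : ν.prod volume (U ∩ {q : P × ℝ | 0 < q.2} ∩
        (fun q => e.symm (g q)) ⁻¹' {x | H x}ᶜ) = 0 := by
      rw [Measure.measure_prod_null hm]
      filter_upwards [hae] with θ hθ
      by_cases hθO : θ ∈ O
      · have h1 := hH _ (hθ hθO) l
        rw [ae_restrict_iff' measurableSet_Ioi, ae_iff] at h1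
        refine measure_mono_null (fun s hs => ?_) h1
        obtain ⟨⟨hsU, hs0⟩, hsH⟩ := hs
        have h2 := (hU _ hsU).2.2.2.2
        intro h3
        have h4 := h3 hs0
        rw [(h2.2 s ⟨le_of_lt hs0, le_of_lt h2.1⟩).2] at h4
        exact hsH h4
      · refine measure_mono_null (fun s hs => ?_) (measure_empty (μ := (volume : Measure ℝ)))
        exact hθO (hU _ hs.1.1).2.2.2.1
    rw [ae_iff]
    refine measure_mono_null (fun q hq => ?_) hnull
    have hq' := Classical.not_imp.1 hq
    exact ⟨hq'.1, hq'.2⟩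

/-- Induction on the codimension `d`. The parameter space grows to `P × ℝ`, so it is quantified
inside; in codimension zero the immersion is a local diffeomorphism. -/
theorem exists_open_ae_of_immersion (hu : ∀ i, IsSmoothField (u i))
    (hc : ∀ i, IsForwardComplete (u i))
    {c : M} {Ω : Set (EuclideanSpace ℝ (Fin n))} (hΩo : IsOpen Ω)
    (hΩ : Ω ⊆ (chartAt (EuclideanSpace ℝ (Fin n)) c).target)
    (hspan : ∀ y ∈ Ω, (generatedAlgebra u).map (localFieldAt c y) = ⊤) {H : M → Prop}
    (hHm : MeasurableSet {x | H x})
    (hH : ∀ x, H x → ∀ i, ∀ᵐ s ∂(volume : Measure ℝ).restrict (Ioi 0), H (flow (u i) s x))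
    (d : ℕ) :
    ∀ (P : Type) [NormedAddCommGroup P] [NormedSpace ℝ P] [FiniteDimensional ℝ P]
      [MeasurableSpace P] [BorelSpace P] (ν : Measure P) [ν.IsAddHaarMeasure]
      (_ : Module.finrank ℝ P + d = n)
      (f : P → EuclideanSpace ℝ (Fin n)) (O : Set P) (_ : IsOpen O) (_ : O.Nonempty)
      (_ : ∀ θ ∈ O, ContDiffAt ℝ 2 f θ) (_ : ∀ θ ∈ O, Function.Injective (fderiv ℝ f θ))
      (_ : ∀ θ ∈ O, f θ ∈ Ω)
      (_ : ∀ᵐ θ ∂ν, θ ∈ O → H ((chartAt (EuclideanSpace ℝ (Fin n)) c).symm (f θ))),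
      ∃ W : Set (EuclideanSpace ℝ (Fin n)), IsOpen W ∧ W.Nonempty ∧ W ⊆ Ω ∧
        ∀ᵐ y, y ∈ W → H ((chartAt (EuclideanSpace ℝ (Fin n)) c).symm y) := by
  induction d with
  | zero =>
    intro P _ _ _ _ _ ν _ hdim f O hO hne hf hinj hfO hae
    obtain ⟨θ₀, hθ₀⟩ := hne
    obtain ⟨W, hWo, hWne, hWf, hW⟩ := exists_open_ae_of_injective
      (volume : Measure (EuclideanSpace ℝ (Fin n))) ν
      (hdim.trans (finrank_euclideanSpace_fin (𝕜 := ℝ)).symm) (hf θ₀ hθ₀) (hinj θ₀ hθ₀)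
      (hO.mem_nhds hθ₀) (G := fun y => H ((chartAt (EuclideanSpace ℝ (Fin n)) c).symm y)) hae
    refine ⟨W, hWo, hWne, hWf.trans ?_, hW⟩
    rintro _ ⟨θ, hθ, rfl⟩
    exact hfO θ hθ
  | succ d ih =>
    intro P _ _ _ _ _ ν _ hdim f O hO hne hf hinj hfO hae
    obtain ⟨θ₀, hθ₀, l, hl⟩ := exists_localField_notMem_range hu hO hne hf hinj
      (fun θ hθ => hΩ (hfO θ hθ)) (fun θ hθ => hspan _ (hfO θ hθ)) (by omega)
    obtain ⟨g, U, hUo, hUne, hg, hgi, hgU, hgae⟩ := exists_immersion_prod hu hc hΩo hΩ hHm hH ν hO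
      hθ₀ hf hinj hfO hae hl
    exact ih (P × ℝ) (ν.prod volume)
      (by rw [Module.finrank_prod, Module.finrank_self]; omega) g U hUo hUne hg hgi hgU hgae

/-- A property that is inherited along almost all points of the trajectories, and that holds at a
point at which the generated algebra spans, holds almost everywhere on a nonempty open set. -/
theorem exists_open_ae (hu : ∀ i, IsSmoothField (u i)) (hc : ∀ i, IsForwardComplete (u i))
    {c : M} {Ω : Set (EuclideanSpace ℝ (Fin n))} (hΩo : IsOpen Ω)
    (hΩ : Ω ⊆ (chartAt (EuclideanSpace ℝ (Fin n)) c).target)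
    (hspan : ∀ y ∈ Ω, (generatedAlgebra u).map (localFieldAt c y) = ⊤) {H : M → Prop}
    (hHm : MeasurableSet {x | H x})
    (hH : ∀ x, H x → ∀ i, ∀ᵐ s ∂(volume : Measure ℝ).restrict (Ioi 0), H (flow (u i) s x))
    {y : EuclideanSpace ℝ (Fin n)} (hy : y ∈ Ω)
    (hHy : H ((chartAt (EuclideanSpace ℝ (Fin n)) c).symm y)) :
    ∃ W : Set (EuclideanSpace ℝ (Fin n)), IsOpen W ∧ W.Nonempty ∧ W ⊆ Ω ∧
      ∀ᵐ y, y ∈ W → H ((chartAt (EuclideanSpace ℝ (Fin n)) c).symm y) :=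
  -- The point `y` is the initial immersed manifold, of dimension zero.
  exists_open_ae_of_immersion hu hc hΩo hΩ hspan hHm hH n (EuclideanSpace ℝ (Fin 0)) volume
    (by simp) (fun _ => y) univ isOpen_univ univ_nonempty (fun _ _ => contDiffAt_const)
    (fun _ _ => Function.injective_of_subsingleton _) (fun _ _ => hy)
    (ae_of_all _ fun _ _ => hHy)

end Krener

/-! ### Contradiction on an open set -/

section AbsoluteContinuity

theorem exists_of_ae_restrict_Ioi_of_eventually {P Q : ℝ → Prop}
    (hP : ∀ᵐ t ∂(volume : Measure ℝ).restrict (Ioi 0), P t) (hQ : ∀ᶠ t in 𝓝[>] (0 : ℝ), Q t) :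
    ∃ t, 0 < t ∧ P t ∧ Q t := by
  obtain ⟨δ, hδ, hδQ⟩ := mem_nhdsGT_iff_exists_Ioo_subset.1 hQ
  by_contra! hcon
  rw [ae_restrict_iff' measurableSet_Ioi, ae_iff] at hP
  have h1 : Ioo 0 δ ⊆ {t : ℝ | ¬(t ∈ Ioi 0 → P t)} := fun t ht h2 =>
    hcon t ht.1 (h2 ht.1) (hδQ ht)
  have h2 := measure_mono_null h1 hP
  rw [Real.volume_Ioo, sub_zero, ENNReal.ofReal_eq_zero] at h2
  exact absurd hδ (not_lt.2 h2)

theorem exists_ne_of_switchingLaw {k : ℕ} (law : SwitchingLaw k) (i : Fin k) : ∃ j, j ≠ i := by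
  by_contra! h
  have h1 := law.jump_sum i
  rw [Finset.sum_eq_zero fun j _ => by rw [h j, law.jump_self]] at h1
  exact zero_ne_one h1

variable {n k : ℕ} {M : Type*} [TopologicalSpace M] [T2Space M] [SecondCountableTopology M]
  [ChartedSpace (EuclideanSpace ℝ (Fin n)) M] [IsManifold (𝓡 n) ∞ M]
  [MeasurableSpace M] [BorelSpace M] {u : Fin k → Π x : M, TangentSpace (𝓡 n) x}
  (hu : ∀ i, IsSmoothField (u i)) (hc : ∀ i, IsForwardComplete (u i))
include hu hc

/-- Trajectories from almost every point avoid a null set at almost all times. -/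
theorem lebesgueMeasure_ae_flow_mem_eq_zero (i : Fin k) {N : Set M} (hNm : MeasurableSet N)
    (hN : lebesgueMeasure n M N = 0) : lebesgueMeasure n M
      {x | ∀ᵐ s ∂(volume : Measure ℝ).restrict (Ioi 0), flow (u i) s x ∈ N} = 0 := by
  obtain ⟨ρ, hρ, h1, h2⟩ := exists_sFinite_equivalent n M
  have hm : MeasurableSet {q : ℝ × M | flow (u i) q.1 q.2 ∈ Nᶜ} :=
    (measurable_flow (hu i) (hc i)) hNm.compl
  have h3 : ∀ᵐ s ∂(volume : Measure ℝ).restrict (Ioi 0), ∀ᵐ x ∂ρ, flow (u i) s x ∈ Nᶜ :=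
    ae_of_all _ fun s => ae_iff.2 (h2 (by
      simpa using lebesgueMeasure_flow_preimage (hu i) (hc i) s hN))
  refine h1 (measure_mono_null (fun x hx => ?_) (ae_iff.1 ((Measure.ae_ae_comm hm).1 h3)))
  intro hx'
  have hx1 : ∀ᵐ s ∂(volume : Measure ℝ).restrict (Ioi 0), flow (u i) s x ∈ N := hx
  obtain ⟨s, -, hs⟩ := exists_gt_of_ae_restrict_Ioi 0 (hx1.and hx')
  exact hs.2 hs.1

theorem absolutelyContinuous_of_isErgodic (law : SwitchingLaw k) {μ : Measure (M × Fin k)}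
    (hμ : IsErgodic u law μ) {η : M} {i : Fin k} (hsupp : (η, i) ∈ μ.support)
    (hB : ConditionB u η) : μ ≪ (lebesgueMeasure n M).prod Measure.count := by
  by_contra hac
  have := hμ.isProbabilityMeasure
  obtain ⟨N, hNm, hN0, hN⟩ := exists_null_carrier hu hc law hμ hac
  set e := chartAt (EuclideanSpace ℝ (Fin n)) η
  have hη : η ∈ e.source := mem_chart_source _ η
  have hspan0 : (generatedAlgebra u).map (localFieldAt η (e η)) = ⊤ :=
    map_localFieldAt_eq_top (e.map_source hη) (by rwa [e.left_inv hη])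
  have htarget : ∀ᶠ y in 𝓝 (e η), y ∈ e.target := e.open_target.mem_nhds (e.map_source hη)
  obtain ⟨Ω, hΩ, hΩo, hηΩ⟩ := eventually_nhds_iff.1
    (htarget.and (eventually_map_localFieldAt_eq_top hu (e.map_source hη) hspan0))
  have hO : IsOpen (e.source ∩ e ⁻¹' Ω) := e.isOpen_inter_preimage hΩo
  have hpos : 0 < μ ((e.source ∩ e ⁻¹' Ω) ×ˢ {i}) := (Measure.mem_support_iff_forall _).1 hsupp _
    (prod_mem_nhds (hO.mem_nhds ⟨hη, hηΩ⟩) ((isOpen_discrete _).mem_nhds rfl))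
  obtain ⟨ξ, hξ, hξN⟩ : ∃ ξ ∈ e.source ∩ e ⁻¹' Ω, StaysIn u law N i ξ := by
    by_contra! hcon
    refine hpos.ne' (measure_mono_null ?_ (ae_iff.1 (ae_staysIn law hu hc hNm hN)))
    rintro ⟨ξ, j⟩ ⟨hξ, rfl⟩
    exact hcon ξ hξ
  -- At `ξ` only the state `i` is controlled. A short move along `u i` reaches a point with the
  -- hereditary property for all states, still in the region where the algebra spans.
  have hsmall : ∀ᶠ s in 𝓝[>] (0 : ℝ), flow (u i) s ξ ∈ e.source ∩ e ⁻¹' Ω := by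
    obtain ⟨h0, hγ⟩ := isForwardTrajectory_flow (hc i) ξ
    have h1 : ContinuousWithinAt (fun s => flow (u i) s ξ) (Ioi 0) 0 :=
      (hγ.continuousOn 0 self_mem_Ici).mono Ioi_subset_Ici_self
    exact h1.eventually_mem (hO.mem_nhds (by simpa only [h0] using hξ))
  obtain ⟨s, -, hsN, hsO⟩ := exists_of_ae_restrict_Ioi_of_eventually
    ((hξN.staysInAlong law hu hc hNm (exists_ne_of_switchingLaw law i)).ae_forall law hu hc hNm)
    hsmall
  have hHm : MeasurableSet {x | ∀ l, StaysInAlong u law N l x} := by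
    have := MeasurableSet.iInter fun l => measurableSet_staysInAlong law hu hc hNm l
    rwa [← ofPred_forall] at this
  obtain ⟨W, hWo, hWne, hWΩ, hW⟩ := exists_open_ae hu hc hΩo (fun y hy => (hΩ y hy).1)
    (fun y hy => (hΩ y hy).2) (H := fun x => ∀ l, StaysInAlong u law N l x) hHm
    (fun x hx l => (hx l).ae_forall law hu hc hNm) hsO.2
    (by rwa [e.left_inv hsO.1])
  have hnull := volume_target_inter_preimage_symm_null η
    (lebesgueMeasure_ae_flow_mem_eq_zero hu hc i
    (measurable_prodMk_right (y := i) hNm) (hN0 i))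
  -- Almost every point of `W` has almost all of its `u i`-trajectory in the slice of `N`; such
  -- points form a null set, yet `W` has positive volume.
  refine (hWo.measure_pos volume hWne).ne' ?_
  refine measure_mono_null (fun y hy => ?_) (measure_union_null hnull (ae_iff.1 hW))
  by_cases hyH : ∀ l, StaysInAlong u law N l (e.symm y)
  · exact Or.inl ⟨(hΩ y (hWΩ hy)).1, (hyH i).1⟩
  · exact Or.inr fun h => hyH (h hy)

end AbsoluteContinuity

end Switching

theorem theorem5 {n k : ℕ} {M : Type*} [TopologicalSpace M] [T2Space M]
    [SecondCountableTopology M] [ChartedSpace (EuclideanSpace ℝ (Fin n)) M]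
    [IsManifold (𝓡 n) ∞ M] [MeasurableSpace M] [BorelSpace M]
    (u : Fin k → Π x : M, TangentSpace (𝓡 n) x)
    (hsmooth : ∀ i, Switching.IsSmoothField (u i))
    (hcomplete : ∀ i, Switching.IsForwardComplete (u i))
    (law : Switching.SwitchingLaw k)
    (μ : Measure (M × Fin k))
    (hμ : Switching.IsErgodic u law μ)
    (η : M) (i : Fin k)
    (hsupp : (η, i) ∈ μ.support)
    (hB : Switching.ConditionB u η) :
    μ ≪ (Switching.lebesgueMeasure n M).prod Measure.count :=
  Switching.absolutelyContinuous_of_isErgodic hsmooth hcomplete law hμ hsupp hB
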